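/- **Notation.** Let $\operatorname{erf}(x)=\frac{2}{\sqrt\pi}\int_0^x e^{-s^2}ds$ and $\operatorname{erfc}=1-\operatorname{erf}$. For $c>0$ and $\alpha>0$ put $$\hat\gamma=\frac{2c-\sqrt{4c^2+16\alpha}}{8},\qquad I_{sph}(c,\alpha)=\hat\gamma-\frac{\alpha}{2c}\log\Bigl(1-\frac{c}{2\hat\gamma}\Bigr).$$ For $\gamma>c/2$ and $\nu_1,\nu_2\ge 0$ let $h$ be a standard normal random variable, $$t=\begin{cases}\dfrac{h^2+\nu_1^2}{4\gamma}+\Bigl|\dfrac{|h|\nu_1}{2\gamma}-\nu_2\Bigr|,&|h|\ge\nu_1,\\[2mm]\max\Bigl(\dfrac{(|h|+\nu_1)^2}{4\gamma}-\nu_2,\ \nu_2\Bigr),&|h|<\nu_1,\end{cases}\qquad I=I(c,\gamma,\nu_1,\nu_2)=\mathbb E\,e^{ct},$$ and, for $0\le\beta\le1$, $$I_{str}(c,\beta)=\inf_{\gamma>c/2,\ \nu_1,\nu_2\ge0}\Bigl(\nu_2(2\beta-1)+\gamma+\frac1c\log I(c,\gamma,\nu_1,\nu_2)\Bigr).$$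 **Theorem (strong threshold, lifted lower bound).** (a) For all $c>0$, $\gamma>c/2$, $\nu_1,\nu_2\ge0$ the expectation $I$ is finite. Put $p=\frac{c}{4\gamma}$, $q=\frac{c\nu_1}{2\gamma}$, $s=\sqrt{1/2-p}$, $e=\frac{q}{\sqrt{2(1-2p)}}$, $C_1=\frac1s\exp\bigl(e^2+c(\frac{\nu_1^2}{4\gamma}-\nu_2)\bigr)$, $C_{12}=\frac1s\exp\bigl(e^2+c(\frac{\nu_1^2}{4\gamma}+\nu_2)\bigr)$. Then: * if $\nu_1^2<2\gamma\nu_2$, $$I=2\Bigl(\tfrac{C_1}{2\sqrt2}\operatorname{erfc}\bigl(\tfrac{2\gamma\nu_2}{\nu_1}s-e\bigr)+\tfrac{C_{12}}{2\sqrt2}\bigl(\operatorname{erfc}(\nu_1s+e)-\operatorname{erfc}(\tfrac{2\gamma\nu_2}{\nu_1}s+e)\bigr)+\tfrac12e^{c\nu_2}\operatorname{erf}\bigl(\tfrac{\nu_1}{\sqrt2}\bigr)\Bigr),$$ where the two terms containing $\nu_1$ in a denominator are read as $\operatorname{erfc}(+\infty)=0$ when $\nu_1=0$; * if $2\gamma\nu_2\le\nu_1^2<8\gamma\nu_2$,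 with $z=\sqrt{8\gamma\nu_2}-\nu_1$, $$I=2\Bigl(\tfrac{C_1}{2\sqrt2}\operatorname{erfc}(\nu_1s-e)+\tfrac12e^{c\nu_2}\operatorname{erf}\bigl(\tfrac{z}{\sqrt2}\bigr)+\tfrac{C_1}{2\sqrt2}\bigl(\operatorname{erfc}(zs-e)-\operatorname{erfc}(\nu_1s-e)\bigr)\Bigr);$$ * if $\nu_1^2\ge8\gamma\nu_2$, $$I=2\Bigl(\tfrac{C_1}{2\sqrt2}\operatorname{erfc}(\nu_1s-e)+\tfrac{C_1}{2\sqrt2}\bigl(\operatorname{erfc}(-e)-\operatorname{erfc}(\nu_1s-e)\bigr)\Bigr).$$ (b) Let $0<\alpha\le1$ and $0\le\beta\le1$ be such that $$\inf_{c>0}\Bigl(-\frac c2+I_{str}(c,\beta)+I_{sph}(c,\alpha)\Bigr)<0 .$$ Then there are constants $C,\eta>0$, depending only on $\alpha$ and $\beta$, such that for all nonnegative integers $n,m,k$ with $|m-\alpha n|<1$ and $|k-\beta n|<1$ (in particular whenever $m=\alpha n$ and $k=\beta n$), and for an $m\times n$ matrix $A$ with i.i.d. standard normal entries, the following holds with probability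 at least $1-Ce^{-\eta n}$: for every $x\in\mathbb R^n$ with at most $k$ nonzero components, $x$ is the unique solution of $$\min_{z\in\mathbb R^n}\|z\|_1\quad\text{subject to}\quad Az=Ax .$$ -/

import Mathlib

open MeasureTheory ProbabilityTheory

namespace L1Recovery

/-! ### Compressed sensing with a Gaussian matrix -/

/-- The vector `x` is `k`-sparse: it has at most `k` nonzero components. -/
def IsSparse {n : ℕ} (k : ℕ) (x : Fin n → ℝ) : Prop :=
  (Finset.univ.filter fun i => x i ≠ 0).card ≤ k

/-- `x` is the (unique) solution of `min ‖z‖₁` subject to `A z = A x`. -/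
def IsL1Solution {m n : ℕ} (A : Matrix (Fin m) (Fin n) ℝ) (x : Fin n → ℝ) : Prop :=
  ∀ z : Fin n → ℝ, A.mulVec z = A.mulVec x → z ≠ x → ∑ i, |x i| < ∑ i, |z i|

/-- `ℓ₁`-minimization with the matrix `A` recovers every `k`-sparse vector. -/
def RecoversAll {m n : ℕ} (A : Matrix (Fin m) (Fin n) ℝ) (k : ℕ) : Prop :=
  ∀ x : Fin n → ℝ, IsSparse k x → IsL1Solution A x

/-- The law of an `m × n` array of i.i.d. standard normal random variables. -/
noncomputable def gaussianEntries (m n : ℕ) : Measure (Fin m → Fin n → ℝ) :=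
  Measure.pi fun _ => Measure.pi fun _ => gaussianReal 0 1

/-! ### The sphere term -/

/-- `γ̂ = (2c - √(4c² + 16α)) / 8`. -/
noncomputable def gammaSph (c α : ℝ) : ℝ :=
  (2 * c - Real.sqrt (4 * c ^ 2 + 16 * α)) / 8

/-- `I_sph(c, α) = γ̂ - (α / 2c) log (1 - c / (2γ̂))`. -/
noncomputable def Isph (c α : ℝ) : ℝ :=
  gammaSph c α - α / (2 * c) * Real.log (1 - c / (2 * gammaSph c α))

/-! ### The strong-threshold term -/

/-- The random variable `t`, as a function of the standard normal variable `h`. -/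
noncomputable def tStr (γ ν₁ ν₂ h : ℝ) : ℝ :=
  if ν₁ ≤ |h| then
    (h ^ 2 + ν₁ ^ 2) / (4 * γ) + |(|h| * ν₁ / (2 * γ) - ν₂)|
  else
    max ((|h| + ν₁) ^ 2 / (4 * γ) - ν₂) ν₂

/-- `I = E exp (c t)`. -/
noncomputable def Imoment (c γ ν₁ ν₂ : ℝ) : ℝ :=
  ∫ h, Real.exp (c * tStr γ ν₁ ν₂ h) ∂(gaussianReal 0 1)

/-- `I_str(c, β)`, the minimum over `γ`, `ν₁`, `ν₂ ≥ 0`. At the end point `γ = c / 2` the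
expectation `E exp (c t)` is infinite, so the range of `γ` is `γ > c / 2`. For `β ≥ 0` the set is
bounded below (by `c / 2`), because `t ≥ ν₂`. -/
noncomputable def Istr (c β : ℝ) : ℝ :=
  sInf {v : ℝ | ∃ γ ν₁ ν₂ : ℝ, c / 2 < γ ∧ 0 ≤ ν₁ ∧ 0 ≤ ν₂ ∧
    v = ν₂ * (2 * β - 1) + γ + 1 / c * Real.log (Imoment c γ ν₁ ν₂)}

/-- The minimum over `c` of `-c/2 + I_str(c, β) + I_sph(c, α)`. The value at `c = 0` is only
meaningful as the limit `c → 0⁺`, so `c > 0` here. For `α > 0`, `β ≥ 0` the set is bounded below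
(by `-√α`). -/
noncomputable def liftedValue (α β : ℝ) : ℝ :=
  sInf {v : ℝ | ∃ c : ℝ, 0 < c ∧ v = -c / 2 + Istr c β + Isph c α}

/-! ### The closed form of the expectation -/

/-- The error function. -/
noncomputable def erf (x : ℝ) : ℝ :=
  2 / Real.sqrt Real.pi * ∫ s in (0 : ℝ)..x, Real.exp (-s ^ 2)

/-- The complementary error function. -/
noncomputable def erfc (x : ℝ) : ℝ := 1 - erf x

/-- `p = c / 4γ`. -/
noncomputable def pPar (c γ : ℝ) : ℝ := c / (4 * γ)

/-- `q = c ν₁ / 2γ`. -/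
noncomputable def qPar (c γ ν₁ : ℝ) : ℝ := c * ν₁ / (2 * γ)

/-- `√(1/2 - p)`. -/
noncomputable def sPar (c γ : ℝ) : ℝ := Real.sqrt (1 / 2 - pPar c γ)

/-- `q / √(2(1 - 2p))`. -/
noncomputable def ePar (c γ ν₁ : ℝ) : ℝ :=
  qPar c γ ν₁ / Real.sqrt (2 * (1 - 2 * pPar c γ))

/-- `C₁ = exp ((q/√(2(1-2p)))² + r) / √(1/2 - p)` with `r = c (ν₁²/4γ - ν₂)`. -/
noncomputable def C₁ (c γ ν₁ ν₂ : ℝ) : ℝ :=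
  Real.exp (ePar c γ ν₁ ^ 2 + c * (ν₁ ^ 2 / (4 * γ) - ν₂)) / sPar c γ

/-- `C₁₂ = exp ((-q/√(2(1-2p)))² + r₁) / √(1/2 - p)` with `r₁ = c (ν₁²/4γ + ν₂)`. -/
noncomputable def C₁₂ (c γ ν₁ ν₂ : ℝ) : ℝ :=
  Real.exp ((-ePar c γ ν₁) ^ 2 + c * (ν₁ ^ 2 / (4 * γ) + ν₂)) / sPar c γ

/-- `erfc ((2γν₂/ν₁) √(1/2 - p) + e)`, read as `erfc (+∞) = 0` when `ν₁ = 0`. -/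
noncomputable def erfcCross (c γ ν₁ ν₂ e : ℝ) : ℝ :=
  if ν₁ = 0 then 0 else erfc (2 * γ * ν₂ / ν₁ * sPar c γ + e)

/-- The value of `E exp (c t)` when `ν₁² < 2γν₂`. -/
noncomputable def closedI1 (c γ ν₁ ν₂ : ℝ) : ℝ :=
  2 * (C₁ c γ ν₁ ν₂ / 2 / Real.sqrt 2 * erfcCross c γ ν₁ ν₂ (-ePar c γ ν₁)
    + C₁₂ c γ ν₁ ν₂ / 2 / Real.sqrt 2 *
        (erfc (ν₁ * sPar c γ + ePar c γ ν₁) - erfcCross c γ ν₁ ν₂ (ePar c γ ν₁))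
    + 1 / 2 * Real.exp (c * ν₂) * erf (ν₁ / Real.sqrt 2))

/-- The value of `E exp (c t)` when `2γν₂ ≤ ν₁² < 8γν₂`. -/
noncomputable def closedI2 (c γ ν₁ ν₂ : ℝ) : ℝ :=
  2 * (C₁ c γ ν₁ ν₂ / 2 / Real.sqrt 2 * erfc (ν₁ * sPar c γ - ePar c γ ν₁)
    + 1 / 2 * Real.exp (c * ν₂) * erf ((Real.sqrt (8 * γ * ν₂) - ν₁) / Real.sqrt 2)
    + C₁ c γ ν₁ ν₂ / 2 / Real.sqrt 2 *
        (erfc ((Real.sqrt (8 * γ * ν₂) - ν₁) * sPar c γ - ePar c γ ν₁)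
          - erfc (ν₁ * sPar c γ - ePar c γ ν₁)))

/-- The value of `E exp (c t)` when `8γν₂ ≤ ν₁²`. -/
noncomputable def closedI3 (c γ ν₁ ν₂ : ℝ) : ℝ :=
  2 * (C₁ c γ ν₁ ν₂ / 2 / Real.sqrt 2 * erfc (ν₁ * sPar c γ - ePar c γ ν₁)
    + C₁ c γ ν₁ ν₂ / 2 / Real.sqrt 2 *
        (erfc (-ePar c γ ν₁) - erfc (ν₁ * sPar c γ - ePar c γ ν₁)))

/-- The closed form of `E exp (c t)` in terms of `erf` and `erfc`. -/
noncomputable def closedI (c γ ν₁ ν₂ : ℝ) : ℝ :=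
  if ν₁ ^ 2 < 2 * γ * ν₂ then closedI1 c γ ν₁ ν₂
  else if ν₁ ^ 2 < 8 * γ * ν₂ then closedI2 c γ ν₁ ν₂
  else closedI3 c γ ν₁ ν₂

end L1Recovery

namespace L1Recovery

/-! ### Gaussian integration by parts -/

/-! Closed form. By `tStr_eq_max`, `t` is an even function of `h`, the maximum of `(|h| + ν₁)² / 4γ
- ν₂` and `(|h| - ν₁)₊² / 4γ + ν₂`. On `h ≥ 0` it is therefore piecewise quadratic or constant, the
three cases being the possible positions of the breakpoints. On each piece, completing the square
against the Gaussian density gives a multiple of `exp (-(s h - e)²)`, whose primitive is an error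
function.

Recovery. If recovery fails, some unit vector `w` with at least half of its `ℓ₁` mass on at most `k`
coordinates satisfies `A w = 0`. The condition `‖A w‖ < 1` is open in `w`, so a countable dense
subset of the cone reduces the claim to finite families of `w`, provided that the bound does not
depend on the size of the family (`measure_not_recoversAll_le`).

For a finite family, Gordon's comparison relates `‖A w‖ + g₀` to `‖g‖ + h·w`. It is proved by
interpolation for the functional `exp (-S)`, where `S` is a sum of exponentials of the smoothed
processes. Since `1 - exp (-S) ≤ S ^ p`, a small `p` depending on the family size `N` replaces `S`
by its largest term at the price of a factor `N ^ p ≤ e`. This gives `gordon_lifted`: the failure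
probability times `P (g₀ ≤ -y)` is at most a constant times `exp (c (3 - y))`, the Laplace transform
of `‖g‖`, and an exponential moment of the width of the cone.

The theorem is this inequality with parameter and level both equal to `c √n`. The Gaussian tail
contributes `-c/2` to the exponent divided by `c n`; Lagrangian duality (`sqrt_mul_sum_le`) bounds
the width by a sum of independent copies of `t`, which produces the objective of `Istr`; a
discretized Gaussian linearization of the norm (`integral_exp_neg_norm_le`) produces `Isph`. The
exponent is then `c n` times a negative number, up to lower-order terms. -/

lemma hasDerivAt_gaussianPDFReal_std (x : ℝ) :
    HasDerivAt (gaussianPDFReal 0 1) (-(x * gaussianPDFReal 0 1 x)) x := by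
  have h1 : HasDerivAt (fun x : ℝ => -(x - 0) ^ 2 / (2 * ((1 : NNReal) : ℝ))) (-x) x := by
    have := (((hasDerivAt_id' x).sub_const (0 : ℝ)).fun_pow 2).fun_neg.div_const
      (2 * ((1 : NNReal) : ℝ))
    refine this.congr_deriv ?_
    simp
    ring
  have h2 := (h1.exp).const_mul (Real.sqrt (2 * Real.pi * (1 : NNReal)))⁻¹
  rw [gaussianPDFReal_def]
  refine h2.congr_deriv ?_
  ring

/-- One-dimensional Gaussian integration by parts for bounded functions. -/
lemma integral_mul_self_gaussianReal_eq {G G' : ℝ → ℝ} {K : ℝ}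
    (hG : ∀ x, HasDerivAt G (G' x) x) (hGK : ∀ x, |G x| ≤ K) (hGK' : ∀ x, |G' x| ≤ K)
    (hm : Continuous G') :
    ∫ x, x * G x ∂(gaussianReal 0 1) = ∫ x, G' x ∂(gaussianReal 0 1) := by
  have hGc : Continuous G := continuous_iff_continuousAt.2 fun x => (hG x).continuousAt
  rw [integral_gaussianReal_eq_integral_smul one_ne_zero,
    integral_gaussianReal_eq_integral_smul one_ne_zero]
  have hφ := integrable_gaussianPDFReal 0 1
  have hid : Integrable (fun x : ℝ => x * gaussianPDFReal 0 1 x) := by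
    have h := (memLp_id_gaussianReal (μ := 0) (v := 1) 1).integrable (by simp)
    rw [gaussianReal_of_var_ne_zero _ one_ne_zero,
      integrable_withDensity_iff_integrable_smul' (measurable_gaussianPDF _ _)
        (by simp [gaussianPDF])] at h
    refine h.congr (Filter.Eventually.of_forall fun x => ?_)
    simp [toReal_gaussianPDF, mul_comm]
  have h1 : Integrable (G * fun x => -(x * gaussianPDFReal 0 1 x)) :=
    hid.neg.bdd_mul hGc.aestronglyMeasurable (Filter.Eventually.of_forall hGK)
  have h2 : Integrable (G' * gaussianPDFReal 0 1) :=
    hφ.bdd_mul hm.aestronglyMeasurable (Filter.Eventually.of_forall hGK')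
  have h3 : Integrable (G * gaussianPDFReal 0 1) :=
    hφ.bdd_mul hGc.aestronglyMeasurable (Filter.Eventually.of_forall hGK)
  have := integral_mul_deriv_eq_deriv_mul_of_integrable (u := G) (v := gaussianPDFReal 0 1)
    (fun x _ => hG x) (fun x _ => hasDerivAt_gaussianPDFReal_std x) h1 h2 h3
  calc ∫ x, gaussianPDFReal 0 1 x • (x * G x)
      = - ∫ x, G x * -(x * gaussianPDFReal 0 1 x) := by
        rw [← integral_neg]; congr 1; ext x; simp only [smul_eq_mul]; ring
    _ = ∫ x, gaussianPDFReal 0 1 x • G' x := by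
        rw [this, neg_neg]; congr 1; ext x; simp only [smul_eq_mul]; ring

/-- The standard Gaussian measure on `ι → ℝ`. -/
noncomputable def stdGauss (ι : Type*) [Fintype ι] : Measure (ι → ℝ) :=
  Measure.pi fun _ => gaussianReal 0 1

section

variable {ι : Type*} [Fintype ι]

instance : IsProbabilityMeasure (stdGauss ι) := by unfold stdGauss; infer_instance

lemma measurePreserving_eval_stdGauss (i : ι) :
    MeasurePreserving (fun ω : ι → ℝ => ω i) (stdGauss ι) (gaussianReal 0 1) :=
  measurePreserving_eval _ i

lemma integrable_eval_stdGauss (i : ι) : Integrable (fun ω : ι → ℝ => ω i) (stdGauss ι) :=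
  (measurePreserving_eval_stdGauss i).integrable_comp_of_integrable
    ((memLp_id_gaussianReal (μ := 0) (v := 1) 1).integrable (by simp))

/-- Resampling one coordinate independently leaves a product law unchanged. Fubini can then isolate
that coordinate, which reduces integration by parts to dimension one. -/
lemma measurePreserving_update [DecidableEq ι] (i : ι) :
    MeasurePreserving (fun p : (ι → ℝ) × ℝ => Function.update p.1 i p.2)
      ((stdGauss ι).prod (gaussianReal 0 1)) (stdGauss ι) := by
  have hm : Measurable fun p : (ι → ℝ) × ℝ => Function.update p.1 i p.2 := by
    refine measurable_pi_lambda _ fun j => ?_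
    by_cases h : j = i
    · subst h; simpa using measurable_snd
    · simpa [Function.update_of_ne h] using measurable_fst.eval
  refine ⟨hm, ?_⟩
  unfold stdGauss
  refine Measure.pi_eq (fun s hs => ?_) |>.symm
  rw [Measure.map_apply hm (MeasurableSet.univ_pi hs)]
  have : (fun p : (ι → ℝ) × ℝ => Function.update p.1 i p.2) ⁻¹' (Set.univ.pi s)
      = (Set.univ.pi (Function.update s i Set.univ)) ×ˢ s i := by
    ext ⟨x, y⟩
    simp only [Set.mem_preimage, Set.mem_pi, Set.mem_univ, true_imp_iff, Set.mem_prod]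
    constructor
    · intro h
      refine ⟨fun j => ?_, by simpa using h i⟩
      by_cases hj : j = i
      · subst hj; simp
      · simpa [Function.update_of_ne hj] using h j
    · rintro ⟨h, hi⟩ j
      by_cases hj : j = i
      · subst hj; simpa using hi
      · simpa [Function.update_of_ne hj] using h j
  rw [this, Measure.prod_prod, Measure.pi_pi,
    ← Finset.mul_prod_erase _ _ (Finset.mem_univ i),
    ← Finset.mul_prod_erase Finset.univ (fun j => gaussianReal 0 1 (s j)) (Finset.mem_univ i)]
  simp only [Function.update_self, measure_univ, one_mul]
  rw [mul_comm]
  congr 1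
  refine Finset.prod_congr rfl fun j hj => ?_
  rw [Function.update_of_ne (Finset.ne_of_mem_erase hj)]

/-- Gaussian integration by parts in the coordinate `i`. -/
lemma integral_eval_mul_stdGauss [DecidableEq ι] (i : ι) {G G' : (ι → ℝ) → ℝ} {K : ℝ}
    (hG : ∀ ω y, HasDerivAt (fun y => G (Function.update ω i y))
      (G' (Function.update ω i y)) y)
    (hGK : ∀ x, |G x| ≤ K) (hGK' : ∀ x, |G' x| ≤ K)
    (hc : Continuous G) (hc' : Continuous G') :
    ∫ ω, ω i * G ω ∂(stdGauss ι) = ∫ ω, G' ω ∂(stdGauss ι) := by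
  have hmp := measurePreserving_update i
  have hi1 : Integrable (fun ω : ι → ℝ => ω i * G ω) (stdGauss ι) :=
    (integrable_eval_stdGauss i).mul_bdd hc.aestronglyMeasurable (Filter.Eventually.of_forall hGK)
  have hi2 : Integrable G' (stdGauss ι) :=
    Integrable.of_bound hc'.aestronglyMeasurable K (Filter.Eventually.of_forall hGK')
  have e1 := integral_map (μ := (stdGauss ι).prod (gaussianReal 0 1)) hmp.measurable.aemeasurable
    (f := fun ω => ω i * G ω) (by rw [hmp.map_eq]; exact hi1.1)
  have e2 := integral_map (μ := (stdGauss ι).prod (gaussianReal 0 1)) hmp.measurable.aemeasurable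
    (f := G') (by rw [hmp.map_eq]; exact hi2.1)
  rw [hmp.map_eq] at e1 e2
  rw [e1, e2, integral_prod (fun p : (ι → ℝ) × ℝ => Function.update p.1 i p.2 i * G (Function.update p.1 i p.2))
      (hmp.integrable_comp_of_integrable hi1),
    integral_prod (fun p : (ι → ℝ) × ℝ => G' (Function.update p.1 i p.2))
      (hmp.integrable_comp_of_integrable hi2)]
  congr 1
  ext ω
  simp only [Function.update_self]
  exact integral_mul_self_gaussianReal_eq (hG ω) (fun _ => hGK _) (fun _ => hGK' _)
    (hc'.comp (continuous_const.update i continuous_id))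

end

/-! ### Gaussian interpolation -/

/-- `F` is a bounded function whose first and second directional derivatives are the bounded
forms `F1` and `F2`. Differentiability is expressed along differentiable curves. -/
structure HasBddDirDeriv {E : Type*} [NormedAddCommGroup E] [NormedSpace ℝ E]
    (F : E → ℝ) (F1 : E → E → ℝ) (F2 : E → E → E → ℝ) (K : ℝ) : Prop where
  deriv1 : ∀ (z : ℝ → E) (z' : E) (t : ℝ), HasDerivAt z z' t →
    HasDerivAt (fun t => F (z t)) (F1 (z t) z') t
  deriv2 : ∀ (a : E) (z : ℝ → E) (z' : E) (t : ℝ), HasDerivAt z z' t →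
    HasDerivAt (fun t => F1 (z t) a) (F2 (z t) z' a) t
  linear1 : ∀ z, IsLinearMap ℝ (F1 z)
  smul2 : ∀ z (s t : ℝ) b a, F2 z (s • b) (t • a) = s * t * F2 z b a
  bound0 : ∀ z, |F z| ≤ K
  bound1 : ∀ z a, |F1 z a| ≤ K * ‖a‖
  bound2 : ∀ z b a, |F2 z b a| ≤ K * (‖b‖ * ‖a‖)
  cont0 : Continuous F
  cont1 : ∀ a, Continuous fun z => F1 z a
  cont2 : ∀ b a, Continuous fun z => F2 z b a

section

variable {ι : Type*} [Fintype ι] {E : Type*} [NormedAddCommGroup E] [NormedSpace ℝ E]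
  {F : E → ℝ} {F1 : E → E → ℝ} {F2 : E → E → E → ℝ} {K : ℝ}

lemma hasDerivAt_sum_update [DecidableEq ι] (c : ι → E) (ω : ι → ℝ) (i : ι) (y : ℝ) :
    HasDerivAt (fun y => ∑ j, Function.update ω i y j • c j) (c i) y := by
  have h := hasDerivAt_pi.1 (hasDerivAt_update ω i y)
  refine (HasDerivAt.fun_sum (u := Finset.univ) fun j _ =>
    (h j).smul_const (c j)).congr_deriv ?_
  rw [Finset.sum_eq_single i]
  · simp
  · intro j _ hj; simp [hj]
  · simp

/-- Integration by parts for a first directional derivative of `F` along a linear image. -/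
lemma HasBddDirDeriv.integral_eval_mul (hF : HasBddDirDeriv F F1 F2 K) (c : ι → E) (a : E)
    (i : ι) :
    ∫ ω, ω i * F1 (∑ j, ω j • c j) a ∂(stdGauss ι)
      = ∫ ω, F2 (∑ j, ω j • c j) (c i) a ∂(stdGauss ι) := by
  classical
  have hK : 0 ≤ K := (abs_nonneg _).trans (hF.bound0 0)
  have hZ : Continuous fun ω : ι → ℝ => ∑ j, ω j • c j := by fun_prop
  refine integral_eval_mul_stdGauss i (K := K * ‖a‖ + K * (‖c i‖ * ‖a‖))
    (fun ω y => hF.deriv2 a _ _ y (hasDerivAt_sum_update c ω i y))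
    (fun ω => (hF.bound1 _ _).trans ?_) (fun ω => (hF.bound2 _ _ _).trans ?_)
    ((hF.cont1 a).comp hZ) ((hF.cont2 _ a).comp hZ)
  · exact le_add_of_nonneg_right (by positivity)
  · exact le_add_of_nonneg_left (by positivity)

/-- The derivative of a Gaussian expectation along a differentiable family of linear images. -/
lemma HasBddDirDeriv.hasDerivAt_integral (hF : HasBddDirDeriv F F1 F2 K) (c c' : ℝ → ι → E)
    (hc : ∀ θ i, HasDerivAt (fun θ => c θ i) (c' θ i) θ) (M : ℝ) (hM : ∀ θ i, ‖c' θ i‖ ≤ M)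
    (θ : ℝ) :
    HasDerivAt (fun θ => ∫ ω, F (∑ i, ω i • c θ i) ∂(stdGauss ι))
      (∑ i, ∫ ω, F2 (∑ j, ω j • c θ j) (c θ i) (c' θ i) ∂(stdGauss ι)) θ := by
  have hK : 0 ≤ K := (abs_nonneg _).trans (hF.bound0 0)
  have hZ : ∀ θ, Continuous fun ω : ι → ℝ => ∑ j, ω j • c θ j := fun θ => by fun_prop
  have hexp : ∀ θ (ω : ι → ℝ), F1 (∑ j, ω j • c θ j) (∑ i, ω i • c' θ i)
      = ∑ i, ω i * F1 (∑ j, ω j • c θ j) (c' θ i) := by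
    intro θ ω
    have hl := hF.linear1 (∑ j, ω j • c θ j)
    exact (map_sum hl.mk' (fun i => ω i • c' θ i) Finset.univ).trans
      (Finset.sum_congr rfl fun i _ => hl.map_smul _ _)
  have hint : ∀ i, Integrable (fun ω : ι → ℝ => ω i * F1 (∑ j, ω j • c θ j) (c' θ i))
      (stdGauss ι) := fun i =>
    (integrable_eval_stdGauss i).mul_bdd ((hF.cont1 _).comp (hZ θ)).aestronglyMeasurable
      (Filter.Eventually.of_forall fun ω => hF.bound1 _ _)
  -- Differentiation under the integral leaves terms `ω i * F1`. They are dominated by multiples of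
  -- `|ω i|` uniformly in `θ`, and integration by parts turns each of them into an `F2`.
  have key := hasDerivAt_integral_of_dominated_loc_of_deriv_le (μ := stdGauss ι)
    (F := fun θ ω => F (∑ i, ω i • c θ i))
    (F' := fun θ ω => ∑ i, ω i * F1 (∑ j, ω j • c θ j) (c' θ i))
    (bound := fun ω => ∑ i, |ω i| * (K * M)) (x₀ := θ) (s := Set.univ) Filter.univ_mem
    (Filter.Eventually.of_forall fun θ => (hF.cont0.comp (hZ θ)).aestronglyMeasurable)
    (Integrable.of_bound (hF.cont0.comp (hZ θ)).aestronglyMeasurable K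
      (Filter.Eventually.of_forall fun ω => hF.bound0 _))
    (integrable_finsetSum _ fun i _ => hint i).aestronglyMeasurable
    (Filter.Eventually.of_forall fun ω θ _ => ?_)
    (integrable_finsetSum _ fun i _ => (integrable_eval_stdGauss i).abs.mul_const _)
    (Filter.Eventually.of_forall fun ω θ _ => ?_)
  · refine key.2.congr_deriv ?_
    rw [integral_finsetSum _ fun i _ => hint i]
    exact Finset.sum_congr rfl fun i _ => hF.integral_eval_mul _ _ _
  · refine (Finset.abs_sum_le_sum_abs _ _).trans (Finset.sum_le_sum fun i _ => ?_)
    rw [abs_mul]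
    gcongr
    exact (hF.bound1 _ _).trans (by gcongr; exact hM _ _)
  · rw [← hexp]
    exact hF.deriv1 _ _ _ (HasDerivAt.fun_sum fun i _ => (hc θ i).const_smul (ω i))

/-- **Gaussian comparison**: if the second derivative of `F` summed over the vectors `b` is at
most that summed over the vectors `a`, then the expectations of `F` compare. -/
theorem HasBddDirDeriv.integral_le_integral {ι₁ ι₂ : Type*} [Fintype ι₁] [Fintype ι₂]
    (hF : HasBddDirDeriv F F1 F2 K) (a : ι₁ → E) (b : ι₂ → E)
    (h : ∀ z, ∑ i, F2 z (b i) (b i) ≤ ∑ i, F2 z (a i) (a i)) :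
    ∫ ω, F (∑ i, ω (Sum.inr i) • b i) ∂(stdGauss (ι₁ ⊕ ι₂))
      ≤ ∫ ω, F (∑ i, ω (Sum.inl i) • a i) ∂(stdGauss (ι₁ ⊕ ι₂)) := by
  -- Rotation path: only the `b` process is present at `θ = 0`, only the `a` process at `π / 2`. The
  -- derivative of the expectation is that of `sin θ cos θ (∑ F2 (a, a) - ∑ F2 (b, b))`, which is
  -- nonnegative.
  let c : ℝ → ι₁ ⊕ ι₂ → E := fun θ =>
    Sum.elim (fun i => Real.sin θ • a i) (fun i => Real.cos θ • b i)
  let c' : ℝ → ι₁ ⊕ ι₂ → E := fun θ =>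
    Sum.elim (fun i => Real.cos θ • a i) (fun i => -Real.sin θ • b i)
  have hc : ∀ θ i, HasDerivAt (fun θ => c θ i) (c' θ i) θ := by
    rintro θ (i | i)
    · exact (Real.hasDerivAt_sin θ).smul_const _
    · exact (Real.hasDerivAt_cos θ).smul_const _
  have hM : ∀ θ i, ‖c' θ i‖ ≤ ∑ i, ‖a i‖ + ∑ i, ‖b i‖ := by
    have ha : ∀ i, ‖a i‖ ≤ ∑ i, ‖a i‖ := fun i =>
      Finset.single_le_sum (f := fun i => ‖a i‖) (fun _ _ => norm_nonneg _) (Finset.mem_univ i)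
    have hb : ∀ i, ‖b i‖ ≤ ∑ i, ‖b i‖ := fun i =>
      Finset.single_le_sum (f := fun i => ‖b i‖) (fun _ _ => norm_nonneg _) (Finset.mem_univ i)
    have ha0 : 0 ≤ ∑ i, ‖a i‖ := Finset.sum_nonneg fun _ _ => norm_nonneg _
    have hb0 : 0 ≤ ∑ i, ‖b i‖ := Finset.sum_nonneg fun _ _ => norm_nonneg _
    rintro θ (i | i)
    · simp only [c', Sum.elim_inl, norm_smul, Real.norm_eq_abs]
      nlinarith [Real.abs_cos_le_one θ, norm_nonneg (a i), ha i]
    · simp only [c', Sum.elim_inr, norm_smul, norm_neg, Real.norm_eq_abs]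
      nlinarith [Real.abs_sin_le_one θ, norm_nonneg (b i), hb i]
  have hd := hF.hasDerivAt_integral c c' hc _ hM
  have hmono : MonotoneOn (fun θ => ∫ ω, F (∑ i, ω i • c θ i) ∂(stdGauss (ι₁ ⊕ ι₂)))
      (Set.Icc 0 (Real.pi / 2)) := by
    refine monotoneOn_of_deriv_nonneg (convex_Icc _ _)
      (fun θ _ => (hd θ).continuousAt.continuousWithinAt)
      (fun θ _ => (hd θ).differentiableAt.differentiableWithinAt) fun θ hθ => ?_
    rw [interior_Icc] at hθ
    have hs : 0 ≤ Real.sin θ := Real.sin_nonneg_of_nonneg_of_le_pi hθ.1.le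
      (by linarith [hθ.2, Real.pi_pos])
    have hcs : 0 ≤ Real.cos θ := Real.cos_nonneg_of_neg_pi_div_two_le_of_le
      (by linarith [hθ.1, Real.pi_pos]) hθ.2.le
    have hZ : Continuous fun ω : ι₁ ⊕ ι₂ → ℝ => ∑ j, ω j • c θ j := by fun_prop
    have hint : ∀ i, Integrable (fun ω : ι₁ ⊕ ι₂ → ℝ =>
        F2 (∑ j, ω j • c θ j) (c θ i) (c' θ i)) (stdGauss (ι₁ ⊕ ι₂)) := fun i =>
      Integrable.of_bound ((hF.cont2 _ _).comp hZ).aestronglyMeasurable _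
        (Filter.Eventually.of_forall fun ω => hF.bound2 _ _ _)
    rw [(hd θ).deriv, ← integral_finsetSum _ fun i _ => hint i]
    refine integral_nonneg fun ω => ?_
    simp only [Fintype.sum_sum_type, c, c', Sum.elim_inl, Sum.elim_inr, hF.smul2]
    rw [← Finset.mul_sum, ← Finset.mul_sum]
    have := mul_le_mul_of_nonneg_left
      (h (∑ x, ω (Sum.inl x) • Real.sin θ • a x + ∑ x, ω (Sum.inr x) • Real.cos θ • b x))
      (mul_nonneg hs hcs)
    simp only [Pi.zero_apply]
    linarith
  have := hmono (Set.left_mem_Icc.2 (by positivity)) (Set.right_mem_Icc.2 (by positivity))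
    (by positivity)
  simpa [c, Fintype.sum_sum_type] using this

end

set_option linter.unusedSectionVars false

/-! ### The smoothed functional -/

section Smooth

variable {V : Type*} [NormedAddCommGroup V] [InnerProductSpace ℝ V]

/-- A smooth approximation of the norm. -/
noncomputable def softNorm (v : V) : ℝ := Real.sqrt (1 + ‖v‖ ^ 2)

lemma softNorm_sq (v : V) : softNorm v ^ 2 = 1 + ‖v‖ ^ 2 := Real.sq_sqrt (by positivity)

lemma one_le_softNorm (v : V) : 1 ≤ softNorm v :=
  Real.one_le_sqrt.2 (by linarith [sq_nonneg ‖v‖])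

lemma softNorm_pos (v : V) : 0 < softNorm v := zero_lt_one.trans_le (one_le_softNorm v)

lemma norm_le_softNorm (v : V) : ‖v‖ ≤ softNorm v :=
  Real.le_sqrt_of_sq_le (by linarith)

lemma softNorm_le (v : V) : softNorm v ≤ 1 + ‖v‖ := by
  refine Real.sqrt_le_iff.2 ⟨by positivity, ?_⟩
  nlinarith [norm_nonneg v]

lemma continuous_softNorm : Continuous (softNorm : V → ℝ) := by
  unfold softNorm; fun_prop

/-- The derivative of `softNorm v + u` in the direction `a`. -/
noncomputable def ell1 (z a : V × ℝ) : ℝ := inner ℝ z.1 a.1 / softNorm z.1 + a.2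

/-- The second derivative of `softNorm`. -/
noncomputable def softNorm2 (v b a : V) : ℝ :=
  inner ℝ b a / softNorm v - inner ℝ v a * inner ℝ v b / softNorm v ^ 3

lemma hasDerivAt_softNorm {v : ℝ → V} {v' : V} {t : ℝ} (h : HasDerivAt v v' t) :
    HasDerivAt (fun t => softNorm (v t)) (inner ℝ (v t) v' / softNorm (v t)) t := by
  have h1 := (h.norm_sq.const_add 1).sqrt (by positivity)
  refine h1.congr_deriv ?_
  unfold softNorm
  field_simp

lemma hasDerivAt_ell1 {z : ℝ → V × ℝ} {z' a : V × ℝ} {t : ℝ} (h : HasDerivAt z z' t) :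
    HasDerivAt (fun t => ell1 (z t) a) (softNorm2 (z t).1 z'.1 a.1) t := by
  have h1 : HasDerivAt (fun t => (z t).1) z'.1 t := h.fst
  have h2 := ((h1.inner ℝ (hasDerivAt_const t a.1)).div (hasDerivAt_softNorm h1)
    (softNorm_pos _).ne').add_const a.2
  refine h2.congr_deriv ?_
  have := (softNorm_pos (z t).1).ne'
  simp only [softNorm2, inner_zero_right, zero_add]
  field_simp

lemma abs_inner_div_softNorm_le (v a : V) : |inner ℝ v a / softNorm v| ≤ ‖a‖ := by
  rw [abs_div, abs_of_pos (softNorm_pos v), div_le_iff₀ (softNorm_pos v)]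
  calc _ ≤ ‖v‖ * ‖a‖ := abs_real_inner_le_norm _ _
    _ ≤ _ := by rw [mul_comm]; gcongr; exact norm_le_softNorm v

lemma abs_ell1_le (z a : V × ℝ) : |ell1 z a| ≤ 2 * ‖a‖ := by
  have h1 := abs_inner_div_softNorm_le z.1 a.1
  have h2 : ‖a.1‖ ≤ ‖a‖ := norm_fst_le a
  have h3 : |a.2| ≤ ‖a‖ := norm_snd_le a
  have := abs_add_le (inner ℝ z.1 a.1 / softNorm z.1) a.2
  unfold ell1
  linarith

lemma abs_softNorm2_le (v b a : V) : |softNorm2 v b a| ≤ 2 * (‖b‖ * ‖a‖) := by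
  have h1 : |inner ℝ b a / softNorm v| ≤ ‖b‖ * ‖a‖ := by
    rw [abs_div, abs_of_pos (softNorm_pos v)]
    exact (div_le_self (abs_nonneg _) (one_le_softNorm v)).trans (abs_real_inner_le_norm _ _)
  have h2 : |inner ℝ v a * inner ℝ v b / softNorm v ^ 3| ≤ ‖b‖ * ‖a‖ := by
    have : inner ℝ v a * inner ℝ v b / softNorm v ^ 3
        = (inner ℝ v a / softNorm v) * (inner ℝ v b / softNorm v) / softNorm v := by
      have := (softNorm_pos v).ne'
      field_simp
    rw [this, abs_div, abs_of_pos (softNorm_pos v)]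
    refine (div_le_self (abs_nonneg _) (one_le_softNorm v)).trans ?_
    rw [abs_mul, mul_comm]
    gcongr <;> exact abs_inner_div_softNorm_le _ _
  have := abs_sub (inner ℝ b a / softNorm v) (inner ℝ v a * inner ℝ v b / softNorm v ^ 3)
  unfold softNorm2
  linarith

lemma continuous_ell1 (a : V × ℝ) : Continuous fun z : V × ℝ => ell1 z a := by
  unfold ell1
  refine Continuous.add (Continuous.div ?_ (continuous_softNorm.comp continuous_fst)
    fun z => (softNorm_pos _).ne') continuous_const
  fun_prop

lemma continuous_softNorm2 (b a : V) : Continuous fun v => softNorm2 v b a := by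
  unfold softNorm2
  refine Continuous.sub (Continuous.div ?_ continuous_softNorm
    fun z => (softNorm_pos _).ne') (Continuous.div ?_ (continuous_softNorm.pow 3)
    fun z => (pow_pos (softNorm_pos _) 3).ne') <;> fun_prop

lemma ell1_add (z a b : V × ℝ) : ell1 z (a + b) = ell1 z a + ell1 z b := by
  simp only [ell1, Prod.fst_add, Prod.snd_add, inner_add_right]; ring

lemma ell1_smul (z a : V × ℝ) (s : ℝ) : ell1 z (s • a) = s * ell1 z a := by
  simp only [ell1, Prod.smul_fst, Prod.smul_snd, inner_smul_right, smul_eq_mul]; ring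

lemma softNorm2_smul (v b a : V) (s t : ℝ) :
    softNorm2 v (s • b) (t • a) = s * t * softNorm2 v b a := by
  simp only [softNorm2, inner_smul_right, inner_smul_left, RCLike.conj_to_real]; ring

/-- The exponential weight of one process. -/
noncomputable def expWeight (κ x : ℝ) (z : V × ℝ) : ℝ :=
  Real.exp (-κ * (softNorm z.1 + z.2 - x))

lemma expWeight_pos (κ x : ℝ) (z : V × ℝ) : 0 < expWeight κ x z := Real.exp_pos _

lemma continuous_expWeight (κ x : ℝ) : Continuous (expWeight κ x : V × ℝ → ℝ) := by
  unfold expWeight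
  have := continuous_softNorm.comp (continuous_fst (X := V) (Y := ℝ))
  simp only [Function.comp_def] at this
  fun_prop

lemma hasDerivAt_expWeight (κ x : ℝ) {z : ℝ → V × ℝ} {z' : V × ℝ} {t : ℝ}
    (h : HasDerivAt z z' t) :
    HasDerivAt (fun t => expWeight κ x (z t)) (-(κ * expWeight κ x (z t) * ell1 (z t) z')) t := by
  have h1 : HasDerivAt (fun t => (z t).1) z'.1 t := h.fst
  have h2 : HasDerivAt (fun t => (z t).2) z'.2 t := h.snd
  have := ((((hasDerivAt_softNorm h1).add h2).sub_const x).const_mul (-κ)).exp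
  refine this.congr_deriv ?_
  simp only [expWeight, ell1, Pi.add_apply]
  ring

variable {J : Type*} [Fintype J]

/-- The sum of the exponential weights. -/
noncomputable def weightSum (κ x : ℝ) (z : J → V × ℝ) : ℝ := ∑ s, expWeight κ x (z s)

/-- The smoothed indicator that all processes exceed the level `x`. -/
noncomputable def softInd (κ x : ℝ) (z : J → V × ℝ) : ℝ := Real.exp (-weightSum κ x z)

/-- The negative of the derivative of `weightSum`. -/
noncomputable def weightSum1 (κ x : ℝ) (z a : J → V × ℝ) : ℝ :=
  ∑ s, κ * expWeight κ x (z s) * ell1 (z s) (a s)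

/-- The negative of the second derivative of `weightSum`. -/
noncomputable def weightSum2 (κ x : ℝ) (z b a : J → V × ℝ) : ℝ :=
  ∑ s, κ * expWeight κ x (z s) *
    (softNorm2 (z s).1 (b s).1 (a s).1 - κ * (ell1 (z s) (b s) * ell1 (z s) (a s)))

/-- The first derivative of `softInd`. -/
noncomputable def softInd1 (κ x : ℝ) (z a : J → V × ℝ) : ℝ :=
  softInd κ x z * weightSum1 κ x z a

/-- The second derivative of `softInd`. -/
noncomputable def softInd2 (κ x : ℝ) (z b a : J → V × ℝ) : ℝ :=
  softInd κ x z * (weightSum1 κ x z b * weightSum1 κ x z a + weightSum2 κ x z b a)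

lemma weightSum_nonneg (κ x : ℝ) (z : J → V × ℝ) : 0 ≤ weightSum κ x z :=
  Finset.sum_nonneg fun _ _ => (expWeight_pos _ _ _).le

lemma softInd_pos (κ x : ℝ) (z : J → V × ℝ) : 0 < softInd κ x z := Real.exp_pos _

lemma softInd_le_one (κ x : ℝ) (z : J → V × ℝ) : softInd κ x z ≤ 1 :=
  Real.exp_le_one_iff.2 (neg_nonpos.2 (weightSum_nonneg _ _ _))

/-- The weights are unbounded, but their first two derivatives are controlled by multiples of `S`
itself, and `exp (-S)` absorbs `S` and `S²`. Hence all derivatives of `softInd` are bounded. -/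
lemma softInd_mul_weightSum_le (κ x : ℝ) (z : J → V × ℝ) :
    softInd κ x z * weightSum κ x z ≤ 1 := by
  unfold softInd
  rw [Real.exp_neg, inv_mul_le_iff₀ (Real.exp_pos _)]
  linarith [Real.add_one_le_exp (weightSum κ x z)]

lemma softInd_mul_weightSum_sq_le (κ x : ℝ) (z : J → V × ℝ) :
    softInd κ x z * weightSum κ x z ^ 2 ≤ 2 := by
  unfold softInd
  rw [Real.exp_neg, inv_mul_le_iff₀ (Real.exp_pos _)]
  nlinarith [Real.quadratic_le_exp_of_nonneg (weightSum_nonneg κ x z), weightSum_nonneg κ x z]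

lemma abs_weightSum1_le {κ : ℝ} (hκ : 0 ≤ κ) (x : ℝ) (z a : J → V × ℝ) :
    |weightSum1 κ x z a| ≤ weightSum κ x z * (2 * κ * ‖a‖) := by
  unfold weightSum1 weightSum
  rw [Finset.sum_mul]
  refine (Finset.abs_sum_le_sum_abs _ _).trans (Finset.sum_le_sum fun s _ => ?_)
  have h0 := (expWeight_pos κ x (z s)).le
  have h1 := (abs_ell1_le (z s) (a s)).trans
    (mul_le_mul_of_nonneg_left (norm_le_pi_norm a s) zero_le_two)
  rw [abs_mul, abs_of_nonneg (mul_nonneg hκ h0)]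
  calc _ ≤ κ * expWeight κ x (z s) * (2 * ‖a‖) := by gcongr
    _ = _ := by ring

lemma abs_weightSum2_le {κ : ℝ} (hκ : 0 ≤ κ) (x : ℝ) (z b a : J → V × ℝ) :
    |weightSum2 κ x z b a| ≤ weightSum κ x z * ((2 * κ + 4 * κ ^ 2) * (‖b‖ * ‖a‖)) := by
  unfold weightSum2 weightSum
  rw [Finset.sum_mul]
  refine (Finset.abs_sum_le_sum_abs _ _).trans (Finset.sum_le_sum fun s _ => ?_)
  have h0 := (expWeight_pos κ x (z s)).le
  have ha := norm_le_pi_norm a s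
  have hb := norm_le_pi_norm b s
  have h1 := (abs_ell1_le (z s) (a s)).trans (mul_le_mul_of_nonneg_left ha zero_le_two)
  have h2 := (abs_ell1_le (z s) (b s)).trans (mul_le_mul_of_nonneg_left hb zero_le_two)
  have h3 : |softNorm2 (z s).1 (b s).1 (a s).1| ≤ 2 * (‖b‖ * ‖a‖) := by
    refine (abs_softNorm2_le _ _ _).trans ?_
    gcongr
    · exact (norm_fst_le _).trans hb
    · exact (norm_fst_le _).trans ha
  have h4 : |κ * (ell1 (z s) (b s) * ell1 (z s) (a s))| ≤ κ * ((2 * ‖b‖) * (2 * ‖a‖)) := by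
    rw [abs_mul, abs_mul, abs_of_nonneg hκ]
    gcongr
  rw [abs_mul, abs_of_nonneg (mul_nonneg hκ h0)]
  calc _ ≤ κ * expWeight κ x (z s) *
        (2 * (‖b‖ * ‖a‖) + κ * ((2 * ‖b‖) * (2 * ‖a‖))) := by
        gcongr
        exact (abs_sub _ _).trans (add_le_add h3 h4)
    _ = _ := by ring

lemma hasDerivAt_weightSum (κ x : ℝ) {z : ℝ → J → V × ℝ} {z' : J → V × ℝ} {t : ℝ}
    (h : HasDerivAt z z' t) :
    HasDerivAt (fun t => weightSum κ x (z t)) (-weightSum1 κ x (z t) z') t := by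
  have := HasDerivAt.fun_sum (u := Finset.univ) fun s _ =>
    hasDerivAt_expWeight κ x (hasDerivAt_pi.1 h s)
  refine this.congr_deriv ?_
  simp only [weightSum1, Finset.sum_neg_distrib]

lemma hasDerivAt_softInd (κ x : ℝ) {z : ℝ → J → V × ℝ} {z' : J → V × ℝ} {t : ℝ}
    (h : HasDerivAt z z' t) :
    HasDerivAt (fun t => softInd κ x (z t)) (softInd1 κ x (z t) z') t := by
  refine (hasDerivAt_weightSum κ x h).fun_neg.exp.congr_deriv ?_
  simp only [softInd1, softInd, neg_neg]

lemma hasDerivAt_softInd1 (κ x : ℝ) {z : ℝ → J → V × ℝ} {z' a : J → V × ℝ} {t : ℝ}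
    (h : HasDerivAt z z' t) :
    HasDerivAt (fun t => softInd1 κ x (z t) a) (softInd2 κ x (z t) z' a) t := by
  have h1 : HasDerivAt (fun t => weightSum1 κ x (z t) a) (weightSum2 κ x (z t) z' a) t := by
    have := HasDerivAt.fun_sum (u := Finset.univ) fun s _ =>
      ((hasDerivAt_expWeight κ x (hasDerivAt_pi.1 h s)).const_mul κ).mul
        (hasDerivAt_ell1 (a := a s) (hasDerivAt_pi.1 h s))
    refine this.congr_deriv (Finset.sum_congr rfl fun s _ => ?_)
    ring
  refine ((hasDerivAt_softInd κ x h).mul h1).congr_deriv ?_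
  simp only [softInd1, softInd2]
  ring

/-- The smoothed functional satisfies the hypotheses of the Gaussian comparison. -/
lemma hasBddDirDeriv_softInd {κ : ℝ} (hκ : 0 ≤ κ) (x : ℝ) :
    HasBddDirDeriv (softInd κ x : (J → V × ℝ) → ℝ) (softInd1 κ x) (softInd2 κ x)
      (1 + 2 * κ + 12 * κ ^ 2) := by
  have c0 : Continuous (weightSum κ x : (J → V × ℝ) → ℝ) := by
    unfold weightSum
    exact continuous_finsetSum _ fun s _ => (continuous_expWeight κ x).comp (continuous_apply s)
  have cI : Continuous (softInd κ x : (J → V × ℝ) → ℝ) := by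
    unfold softInd; fun_prop
  have c1 : ∀ a, Continuous fun z : J → V × ℝ => weightSum1 κ x z a := fun a => by
    unfold weightSum1
    exact continuous_finsetSum _ fun s _ =>
      (continuous_const.mul ((continuous_expWeight κ x).comp (continuous_apply s))).mul
        ((continuous_ell1 _).comp (continuous_apply s))
  have c2 : ∀ b a, Continuous fun z : J → V × ℝ => weightSum2 κ x z b a := fun b a => by
    unfold weightSum2
    exact continuous_finsetSum _ fun s _ =>
      (continuous_const.mul ((continuous_expWeight κ x).comp (continuous_apply s))).mul
        (((continuous_softNorm2 _ _).comp (continuous_fst.comp (continuous_apply s))).sub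
          (continuous_const.mul (((continuous_ell1 _).comp (continuous_apply s)).mul
            ((continuous_ell1 _).comp (continuous_apply s)))))
  refine ⟨fun z z' t h => hasDerivAt_softInd κ x h, fun a z z' t h => hasDerivAt_softInd1 κ x h,
    fun z => ⟨fun a b => ?_, fun s a => ?_⟩, fun z s t b a => ?_, fun z => ?_, fun z a => ?_,
    fun z b a => ?_, cI, fun a => cI.mul (c1 a),
    fun b a => cI.mul (((c1 b).mul (c1 a)).add (c2 b a))⟩
  · simp only [softInd1, weightSum1, Pi.add_apply, ell1_add, mul_add, Finset.sum_add_distrib]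
  · simp only [softInd1, weightSum1, Pi.smul_apply, ell1_smul, smul_eq_mul, Finset.mul_sum]
    exact Finset.sum_congr rfl fun _ _ => by ring
  · have h1 : ∀ (s : ℝ) (a : J → V × ℝ), weightSum1 κ x z (s • a) = s * weightSum1 κ x z a := by
      intro s a
      simp only [weightSum1, Pi.smul_apply, ell1_smul, Finset.mul_sum]
      exact Finset.sum_congr rfl fun _ _ => by ring
    have h2 : weightSum2 κ x z (s • b) (t • a) = s * t * weightSum2 κ x z b a := by
      simp only [weightSum2, Pi.smul_apply, Prod.smul_fst, ell1_smul, softNorm2_smul,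
        Finset.mul_sum]
      exact Finset.sum_congr rfl fun _ _ => by ring
    simp only [softInd2, h1, h2]
    ring
  · rw [abs_of_pos (softInd_pos _ _ _)]
    nlinarith [softInd_le_one κ x z, sq_nonneg κ]
  · rw [softInd1, abs_mul, abs_of_pos (softInd_pos _ _ _)]
    calc _ ≤ softInd κ x z * (weightSum κ x z * (2 * κ * ‖a‖)) := by
          have := (softInd_pos κ x z).le
          gcongr
          exact abs_weightSum1_le hκ x z a
      _ = (softInd κ x z * weightSum κ x z) * (2 * κ * ‖a‖) := by ring
      _ ≤ 1 * (2 * κ * ‖a‖) := by gcongr; exact softInd_mul_weightSum_le _ _ _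
      _ ≤ _ := by
          have := norm_nonneg a
          nlinarith [mul_nonneg (sq_nonneg κ) this]
  · rw [softInd2, abs_mul, abs_of_pos (softInd_pos _ _ _)]
    have hI := (softInd_pos κ x z).le
    have hS := weightSum_nonneg κ x z
    calc _ ≤ softInd κ x z * ((weightSum κ x z * (2 * κ * ‖b‖)) * (weightSum κ x z * (2 * κ * ‖a‖))
            + weightSum κ x z * ((2 * κ + 4 * κ ^ 2) * (‖b‖ * ‖a‖))) := by
          gcongr
          refine (abs_add_le _ _).trans (add_le_add ?_ (abs_weightSum2_le hκ x z b a))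
          rw [abs_mul]
          gcongr <;> exact abs_weightSum1_le hκ x z _
      _ = (softInd κ x z * weightSum κ x z ^ 2) * (4 * κ ^ 2 * (‖b‖ * ‖a‖))
            + (softInd κ x z * weightSum κ x z) * ((2 * κ + 4 * κ ^ 2) * (‖b‖ * ‖a‖)) := by ring
      _ ≤ 2 * (4 * κ ^ 2 * (‖b‖ * ‖a‖)) + 1 * ((2 * κ + 4 * κ ^ 2) * (‖b‖ * ‖a‖)) := by
          gcongr
          · exact softInd_mul_weightSum_sq_le _ _ _
          · exact softInd_mul_weightSum_le _ _ _
      _ ≤ _ := by nlinarith [mul_nonneg (norm_nonneg b) (norm_nonneg a)]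

end Smooth

/-! ### The comparison of the two processes -/

section Gordon

variable {m n : ℕ} {J : Type*} [Fintype J]

/-- Coefficients of the process `A w + g₀`. -/
noncomputable def matVec (w : J → Fin n → ℝ) :
    (Fin m × Fin n) ⊕ Unit → J → EuclideanSpace ℝ (Fin m) × ℝ :=
  Sum.elim (fun p s => (w s p.2 • EuclideanSpace.single p.1 1, 0)) (fun _ _ => (0, 1))

/-- Coefficients of the decoupled process `g + h·w`. -/
noncomputable def decVec (w : J → Fin n → ℝ) :
    Fin m ⊕ Fin n → J → EuclideanSpace ℝ (Fin m) × ℝ :=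
  Sum.elim (fun i _ => (EuclideanSpace.single i 1, 0)) (fun j s => (0, w s j))

lemma sum_sq_sum_eq {K : Type*} [Fintype K] (l : J → ℝ) (v : J → K → ℝ) :
    ∑ k, (∑ s, l s * v s k) ^ 2 = ∑ s, ∑ s', l s * l s' * ∑ k, v s k * v s' k := by
  simp_rw [sq, Finset.sum_mul_sum, Finset.mul_sum]
  rw [Finset.sum_comm]
  refine Finset.sum_congr rfl fun s _ => ?_
  rw [Finset.sum_comm]
  exact Finset.sum_congr rfl fun s' _ => Finset.sum_congr rfl fun k _ => by ring

/-- Expanding the squares into double sums, the right side minus the left is the sum over `s`, `s'`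
of `l s * l s' * (1 - ⟨u s, u s'⟩) * (1 - ⟨w s, w s'⟩)`. This is the covariance inequality behind
Gordon's theorem. -/
lemma sum_sq_add_le {K L : Type*} [Fintype K] [Fintype L] (l : J → ℝ) (hl : ∀ s, 0 ≤ l s)
    (u : J → K → ℝ) (w : J → L → ℝ) (hu : ∀ s s', ∑ k, u s k * u s' k ≤ 1)
    (hw : ∀ s s', ∑ k, w s k * w s' k ≤ 1) :
    ∑ i, (∑ s, l s * u s i) ^ 2 + ∑ j, (∑ s, l s * w s j) ^ 2
      ≤ ∑ p : K × L, (∑ s, l s * (w s p.2 * u s p.1)) ^ 2 + (∑ s, l s) ^ 2 := by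
  rw [sum_sq_sum_eq, sum_sq_sum_eq, sum_sq_sum_eq l fun s (p : K × L) => w s p.2 * u s p.1, sq,
    Finset.sum_mul_sum, ← Finset.sum_add_distrib, ← Finset.sum_add_distrib]
  refine Finset.sum_le_sum fun s _ => ?_
  rw [← Finset.sum_add_distrib, ← Finset.sum_add_distrib]
  refine Finset.sum_le_sum fun s' _ => ?_
  have h : ∑ p : K × L, w s p.2 * u s p.1 * (w s' p.2 * u s' p.1)
      = (∑ k, u s k * u s' k) * ∑ k, w s k * w s' k := by
    rw [Finset.sum_mul_sum, Fintype.sum_prod_type]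
    exact Finset.sum_congr rfl fun _ _ => Finset.sum_congr rfl fun _ _ => by ring
  rw [h]
  nlinarith [mul_nonneg (mul_nonneg (hl s) (hl s'))
    (mul_nonneg (sub_nonneg.2 (hu s s')) (sub_nonneg.2 (hw s s')))]

lemma sum_mul_le_one {K : Type*} [Fintype K] {a b : K → ℝ} (ha : ∑ k, a k ^ 2 ≤ 1)
    (hb : ∑ k, b k ^ 2 ≤ 1) : ∑ k, a k * b k ≤ 1 := by
  have : ∑ k, a k * b k ≤ ∑ k, (a k ^ 2 + b k ^ 2) / 2 :=
    Finset.sum_le_sum fun k _ => by linarith [sq_nonneg (a k - b k)]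
  rw [← Finset.sum_div, Finset.sum_add_distrib] at this
  linarith

lemma softInd2_sum_le (w : J → Fin n → ℝ) (hw : ∀ s, ∑ j, w s j ^ 2 = 1) {κ : ℝ} (hκ : 0 ≤ κ)
    (x : ℝ) (z : J → EuclideanSpace ℝ (Fin m) × ℝ) :
    ∑ i, softInd2 κ x z (decVec w i) (decVec w i)
      ≤ ∑ i, softInd2 κ x z (matVec w i) (matVec w i) := by
  -- The terms involving a single process agree, because `w s` has unit length: both processes have
  -- the same covariance at each fixed `s`.
  have h2 : ∑ i, weightSum2 κ x z (decVec w i) (decVec w i)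
      = ∑ i, weightSum2 κ x z (matVec w i) (matVec w i) := by
    unfold weightSum2
    rw [Finset.sum_comm, Finset.sum_comm (s := Finset.univ (α := (Fin m × Fin n) ⊕ Unit))]
    refine Finset.sum_congr rfl fun s _ => ?_
    rw [← Finset.mul_sum, ← Finset.mul_sum]
    congr 1
    have h (j : Fin n) (i : Fin m) : softNorm2 (z s).1
          (w s j • EuclideanSpace.single i 1) (w s j • EuclideanSpace.single i 1)
        - κ * (ell1 (z s) (w s j • EuclideanSpace.single i 1, 0)
          * ell1 (z s) (w s j • EuclideanSpace.single i 1, 0))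
        = w s j ^ 2 * (softNorm2 (z s).1 (EuclideanSpace.single i 1) (EuclideanSpace.single i 1)
        - κ * (ell1 (z s) (EuclideanSpace.single i 1, 0)
          * ell1 (z s) (EuclideanSpace.single i 1, 0))) := by
      simp only [softNorm2_smul, ell1, inner_smul_right]
      ring
    have h0 (r r' : ℝ) : softNorm2 (z s).1 (0 : EuclideanSpace ℝ (Fin m)) 0
        - κ * (ell1 (z s) (0, r) * ell1 (z s) (0, r')) = -κ * (r * r') := by
      simp [softNorm2, ell1]
    simp only [Fintype.sum_sum_type, decVec, matVec, Sum.elim_inl, Sum.elim_inr,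
      Fintype.sum_prod_type, h, h0, ← Finset.sum_mul, ← Finset.mul_sum, hw]
    simp [← sq, hw]
  -- The mixed terms are compared with `u s` the gradient of `softNorm`, a vector of length at most
  -- one.
  have h1 : ∑ i, weightSum1 κ x z (decVec w i) ^ 2
      ≤ ∑ i, weightSum1 κ x z (matVec w i) ^ 2 := by
    have := sum_sq_add_le (fun s => κ * expWeight κ x (z s))
      (fun s => mul_nonneg hκ (expWeight_pos _ _ _).le)
      (fun s i => (z s).1 i / softNorm (z s).1) w
      (fun s s' => sum_mul_le_one ?_ ?_) (fun s s' => sum_mul_le_one (hw s).le (hw s').le)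
    · simpa [Fintype.sum_sum_type, decVec, matVec, weightSum1, ell1, inner_smul_right,
        EuclideanSpace.inner_single_right, mul_div_assoc] using this
    all_goals
      simp only [div_pow]
      rw [← Finset.sum_div, softNorm_sq, EuclideanSpace.norm_sq_eq]
      refine div_le_one_of_le₀ ?_ (by positivity)
      simp only [Real.norm_eq_abs, sq_abs]
      linarith
  simp only [softInd2, ← Finset.mul_sum, Finset.sum_add_distrib, ← sq]
  rw [h2]
  have := (softInd_pos κ x z).le
  gcongr

/-- **Gordon's comparison inequality** for the smoothed functional. -/
theorem integral_softInd_decVec_le (w : J → Fin n → ℝ) (hw : ∀ s, ∑ j, w s j ^ 2 = 1) {κ : ℝ}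
    (hκ : 0 ≤ κ) (x : ℝ) :
    ∫ ω, softInd κ x (∑ i, ω (Sum.inr i) • (decVec w i : J → EuclideanSpace ℝ (Fin m) × ℝ))
        ∂(stdGauss (((Fin m × Fin n) ⊕ Unit) ⊕ (Fin m ⊕ Fin n)))
      ≤ ∫ ω, softInd κ x (∑ i, ω (Sum.inl i) • (matVec w i : J → EuclideanSpace ℝ (Fin m) × ℝ))
        ∂(stdGauss (((Fin m × Fin n) ⊕ Unit) ⊕ (Fin m ⊕ Fin n))) :=
  (hasBddDirDeriv_softInd hκ x).integral_le_integral _ _ (softInd2_sum_le w hw hκ x)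

end Gordon

/-! ### Transfer to product spaces and the lifted Gordon inequality -/

instance (m n : ℕ) : IsProbabilityMeasure (gaussianEntries m n) := by
  unfold gaussianEntries; infer_instance

section

variable {m n : ℕ}

/-- Assemble a matrix, a scalar and two vectors into one family of coordinates. -/
def assemble (ω : ((Fin m → Fin n → ℝ) × ℝ) × ((Fin m → ℝ) × (Fin n → ℝ))) :
    ((Fin m × Fin n) ⊕ Unit) ⊕ (Fin m ⊕ Fin n) → ℝ :=
  Sum.elim (Sum.elim (fun p => ω.1.1 p.1 p.2) (fun _ => ω.1.2)) (Sum.elim ω.2.1 ω.2.2)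

lemma measurePreserving_assemble :
    MeasurePreserving (assemble (m := m) (n := n))
      (((gaussianEntries m n).prod (gaussianReal 0 1)).prod
        ((stdGauss (Fin m)).prod (stdGauss (Fin n)))) (stdGauss _) := by
  have hm : Measurable (assemble (m := m) (n := n)) := by
    refine measurable_pi_lambda _ ?_
    rintro ((⟨i, j⟩ | _) | (i | j)) <;> simp only [assemble, Sum.elim_inl, Sum.elim_inr] <;>
      fun_prop
  refine ⟨hm, ?_⟩
  unfold stdGauss gaussianEntries
  refine (Measure.pi_eq fun s hs => ?_).symm
  rw [Measure.map_apply hm (MeasurableSet.univ_pi hs)]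
  have : assemble (m := m) (n := n) ⁻¹' (Set.univ.pi s)
      = ((Set.univ.pi fun i => Set.univ.pi fun j => s (Sum.inl (Sum.inl (i, j))))
          ×ˢ s (Sum.inl (Sum.inr ()))) ×ˢ
        ((Set.univ.pi fun i => s (Sum.inr (Sum.inl i))) ×ˢ
          (Set.univ.pi fun j => s (Sum.inr (Sum.inr j)))) := by
    ext ω
    simp [assemble, Set.mem_pi]
    exact fun _ _ _ => ⟨fun h => h (), fun h _ => h⟩
  rw [this]
  simp [Measure.prod_prod, Measure.pi_pi, Fintype.prod_sum_type, Fintype.prod_prod_type]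

lemma integral_comp_measurePreserving {α β : Type*} [MeasurableSpace α]
    [MeasurableSpace β] {μ : Measure α} {ν : Measure β} {T : α → β} (hT : MeasurePreserving T μ ν)
    {f : β → ℝ} (hf : AEStronglyMeasurable f ν) : ∫ x, f (T x) ∂μ = ∫ y, f y ∂ν := by
  rw [← hT.map_eq] at hf ⊢
  exact (integral_map hT.measurable.aemeasurable hf).symm

variable {J : Type*} [Fintype J]

lemma continuous_softInd {V : Type*} [NormedAddCommGroup V] [InnerProductSpace ℝ V] {κ : ℝ}
    (hκ : 0 ≤ κ) (x : ℝ) : Continuous (softInd κ x : (J → V × ℝ) → ℝ) :=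
  (hasBddDirDeriv_softInd hκ x).cont0

lemma integrable_softInd {Ω V : Type*} [MeasurableSpace Ω] [TopologicalSpace Ω]
    [OpensMeasurableSpace Ω] [SecondCountableTopology Ω]
    {μ : Measure Ω} [IsFiniteMeasure μ] [NormedAddCommGroup V] [InnerProductSpace ℝ V]
    {κ : ℝ} (hκ : 0 ≤ κ) (x : ℝ) {Z : Ω → J → V × ℝ} (hZ : Continuous Z) :
    Integrable (fun ω => softInd κ x (Z ω)) μ :=
  Integrable.of_bound ((continuous_softInd hκ x).comp hZ).aestronglyMeasurable 1
    (Filter.Eventually.of_forall fun ω => by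
      rw [Real.norm_eq_abs, abs_of_pos (softInd_pos _ _ _)]; exact softInd_le_one _ _ _)

/-- Gordon's comparison inequality on product spaces. -/
theorem integral_softInd_le (w : J → Fin n → ℝ) (hw : ∀ s, ∑ j, w s j ^ 2 = 1) {κ : ℝ}
    (hκ : 0 ≤ κ) (x : ℝ) :
    ∫ p, softInd κ x (fun s => (WithLp.toLp 2 p.1, ∑ j, p.2 j * w s j))
        ∂((stdGauss (Fin m)).prod (stdGauss (Fin n)))
      ≤ ∫ p, softInd κ x (fun s => (WithLp.toLp 2 ((Matrix.of p.1).mulVec (w s)), p.2))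
        ∂((gaussianEntries m n).prod (gaussianReal 0 1)) := by
  have h := integral_softInd_decVec_le (m := m) w hw hκ x
  have hT := measurePreserving_assemble (m := m) (n := n)
  have hc := continuous_softInd (J := J) (V := EuclideanSpace ℝ (Fin m)) hκ x
  have cY : Continuous fun ω : ((Fin m × Fin n) ⊕ Unit) ⊕ (Fin m ⊕ Fin n) → ℝ =>
      ∑ i, ω (Sum.inr i) • (decVec w i : J → EuclideanSpace ℝ (Fin m) × ℝ) := by fun_prop
  have cX : Continuous fun ω : ((Fin m × Fin n) ⊕ Unit) ⊕ (Fin m ⊕ Fin n) → ℝ =>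
      ∑ i, ω (Sum.inl i) • (matVec w i : J → EuclideanSpace ℝ (Fin m) × ℝ) := by fun_prop
  rw [← integral_comp_measurePreserving hT (f := fun ω => softInd κ x (∑ i, ω (Sum.inr i) •
      (decVec w i : J → EuclideanSpace ℝ (Fin m) × ℝ))) (hc.comp cY).aestronglyMeasurable,
    ← integral_comp_measurePreserving hT (f := fun ω => softInd κ x (∑ i, ω (Sum.inl i) •
      (matVec w i : J → EuclideanSpace ℝ (Fin m) × ℝ))) (hc.comp cX).aestronglyMeasurable] at h
  have eY : ∀ ω : ((Fin m → Fin n → ℝ) × ℝ) × ((Fin m → ℝ) × (Fin n → ℝ)),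
      ∑ i, assemble ω (Sum.inr i) • (decVec w i : J → EuclideanSpace ℝ (Fin m) × ℝ)
        = fun s => (WithLp.toLp 2 ω.2.1, ∑ j, ω.2.2 j * w s j) := by
    intro ω
    ext s i
    · simp [assemble, decVec, Fintype.sum_sum_type, Finset.sum_apply, Prod.fst_sum,
        Pi.single_apply]
    · simp [assemble, decVec, Fintype.sum_sum_type, Finset.sum_apply, Prod.snd_sum]
  have eX : ∀ ω : ((Fin m → Fin n → ℝ) × ℝ) × ((Fin m → ℝ) × (Fin n → ℝ)),
      ∑ i, assemble ω (Sum.inl i) • (matVec w i : J → EuclideanSpace ℝ (Fin m) × ℝ)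
        = fun s => (WithLp.toLp 2 ((Matrix.of ω.1.1).mulVec (w s)), ω.1.2) := by
    intro ω
    ext s i
    · simp [assemble, matVec, Fintype.sum_sum_type, Finset.sum_apply, Prod.fst_sum,
        Fintype.sum_prod_type, Matrix.mulVec, dotProduct]
      rw [Finset.sum_comm]
      simp [Pi.single_apply]
    · simp [assemble, matVec, Fintype.sum_sum_type, Finset.sum_apply, Prod.snd_sum]
  simp only [eY, eX] at h
  have cX' : Continuous fun p : (Fin m → Fin n → ℝ) × ℝ => fun s : J =>
      ((WithLp.toLp 2 ((Matrix.of p.1).mulVec (w s)) : EuclideanSpace ℝ (Fin m)), p.2) := by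
    fun_prop
  have cY' : Continuous fun p : (Fin m → ℝ) × (Fin n → ℝ) => fun s : J =>
      ((WithLp.toLp 2 p.1 : EuclideanSpace ℝ (Fin m)), ∑ j, p.2 j * w s j) := by
    fun_prop
  rwa [integral_comp_measurePreserving measurePreserving_snd
      (f := fun p : (Fin m → ℝ) × (Fin n → ℝ) =>
        softInd κ x (fun s => (WithLp.toLp 2 p.1, ∑ j, p.2 j * w s j)))
      (hc.comp cY').aestronglyMeasurable,
    integral_comp_measurePreserving measurePreserving_fst
      (f := fun p : (Fin m → Fin n → ℝ) × ℝ =>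
        softInd κ x (fun s => (WithLp.toLp 2 ((Matrix.of p.1).mulVec (w s)), p.2)))
      (hc.comp cX').aestronglyMeasurable] at h

/-- The left side is at most `min S 1`. The free exponent `p` is what later removes the dependence
on the number of vectors. -/
lemma one_sub_exp_neg_le_rpow {S p : ℝ} (hS : 0 ≤ S) (hp : 0 ≤ p) (hp1 : p ≤ 1) :
    1 - Real.exp (-S) ≤ S ^ p := by
  rcases le_total S 1 with h | h
  · have h1 : 1 - Real.exp (-S) ≤ S := by linarith [Real.add_one_le_exp (-S)]
    exact h1.trans (Real.self_le_rpow_of_le_one hS h hp1)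
  · have h1 : 1 - Real.exp (-S) ≤ 1 := by linarith [Real.exp_pos (-S)]
    exact h1.trans (Real.one_le_rpow h hp)

/-- The lifted form of Gordon's inequality: an upper bound for the probability that a Gaussian
matrix nearly annihilates one of finitely many unit vectors. -/
theorem gordon_lifted (w : J → Fin n → ℝ) (hw : ∀ s, ∑ j, w s j ^ 2 = 1) {c : ℝ} (hc : 0 < c)
    (y : ℝ) (R : (Fin n → ℝ) → ℝ) (hR : ∀ s h, -(c * ∑ j, h j * w s j) ≤ R h)
    (hRi : Integrable (fun h => Real.exp (R h)) (stdGauss (Fin n))) :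
    (gaussianEntries m n).real
        {A | ∃ s, ‖WithLp.toLp 2 ((Matrix.of A).mulVec (w s))‖ < 1} *
        (gaussianReal 0 1).real (Set.Iic (-y))
      ≤ 2 * Real.exp 1 * Real.exp (c * (3 - y)) *
        (∫ g, Real.exp (-c * ‖WithLp.toLp 2 g‖) ∂(stdGauss (Fin m))) *
        ∫ h, Real.exp (R h) ∂(stdGauss (Fin n)) := by
  set N : ℝ := (Fintype.card J : ℝ) with hN
  have hN0 : 0 ≤ N := Nat.cast_nonneg _
  have hlog : 0 ≤ Real.log (N + 1) := Real.log_nonneg (by linarith)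
  -- Small enough that `N ^ p ≤ e`. With `κ = c / p`, raising a weight to the power `p` restores the
  -- exponential rate `c` whatever `N` is.
  set p : ℝ := (1 + Real.log (N + 1))⁻¹ with hp
  have hp0 : 0 < p := by positivity
  have hp1 : p ≤ 1 := inv_le_one_of_one_le₀ (by linarith)
  set κ : ℝ := c / p with hκ
  have hκ0 : 0 < κ := by positivity
  have hNp : N ^ p ≤ Real.exp 1 := by
    calc N ^ p ≤ (N + 1) ^ p := Real.rpow_le_rpow hN0 (by linarith) hp0.le
      _ = Real.exp (Real.log (N + 1) * p) := Real.rpow_def_of_pos (by linarith) _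
      _ ≤ Real.exp 1 := by
        refine Real.exp_le_exp.2 ?_
        rw [hp, ← div_eq_mul_inv, div_le_one (by positivity)]
        linarith
  set x : ℝ := 3 - y with hx
  set P := (gaussianEntries m n).prod (gaussianReal 0 1)
  set Q := (stdGauss (Fin m)).prod (stdGauss (Fin n))
  set X : (Fin m → Fin n → ℝ) × ℝ → J → EuclideanSpace ℝ (Fin m) × ℝ :=
    fun p s => (WithLp.toLp 2 ((Matrix.of p.1).mulVec (w s)), p.2) with hX
  set Y : (Fin m → ℝ) × (Fin n → ℝ) → J → EuclideanSpace ℝ (Fin m) × ℝ :=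
    fun p s => (WithLp.toLp 2 p.1, ∑ j, p.2 j * w s j) with hY
  have cX : Continuous X := by
    simp only [hX]
    fun_prop
  have cY : Continuous Y := by
    simp only [hY]
    fun_prop
  have hmain : ∫ p, softInd κ x (Y p) ∂Q ≤ ∫ p, softInd κ x (X p) ∂P :=
    integral_softInd_le w hw hκ0.le x
  have iX : Integrable (fun p => softInd κ x (X p)) P := integrable_softInd hκ0.le x cX
  have iY : Integrable (fun p => softInd κ x (Y p)) Q := integrable_softInd hκ0.le x cY
  set B : Set (Fin m → Fin n → ℝ) :=
    {A | ∃ s, ‖WithLp.toLp 2 ((Matrix.of A).mulVec (w s))‖ < 1} with hB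
  have mB : MeasurableSet B := by
    have : B = ⋃ s, {A | ‖WithLp.toLp 2 ((Matrix.of A).mulVec (w s))‖ < 1} := by
      ext A; simp [hB]
    rw [this]
    refine (isOpen_iUnion fun s => ?_).measurableSet
    refine isOpen_lt ?_ continuous_const
    fun_prop
  -- On the event `B ∩ {g₀ ≤ -y}` some `softNorm` is below `2`, so that process is below the level
  -- `x = 3 - y`. Its weight is at least `1`, and `1 - softInd ≥ 1 - 1/e ≥ 1/2`.
  have hlow : (gaussianEntries m n).real B * (gaussianReal 0 1).real (Set.Iic (-y)) * (1 / 2)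
      ≤ 1 - ∫ p, softInd κ x (X p) ∂P := by
    have e1 : (gaussianEntries m n).real B * (gaussianReal 0 1).real (Set.Iic (-y)) * (1 / 2)
        = ∫ p, (B ×ˢ Set.Iic (-y)).indicator (fun _ => (1 / 2 : ℝ)) p ∂P := by
      rw [integral_indicator_const _ (mB.prod measurableSet_Iic), measureReal_prod_prod,
        smul_eq_mul]
    have e2 : 1 - ∫ p, softInd κ x (X p) ∂P = ∫ p, (1 - softInd κ x (X p)) ∂P := by
      rw [integral_sub (integrable_const _) iX]
      simp
    rw [e1, e2]
    refine integral_mono ((integrable_const _).indicator (mB.prod measurableSet_Iic))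
      ((integrable_const _).sub iX) fun q => ?_
    by_cases hq : q ∈ B ×ˢ Set.Iic (-y)
    · rw [Set.indicator_of_mem hq]
      obtain ⟨⟨s, hs⟩, hqy⟩ := hq
      have h1 : 1 ≤ expWeight κ x (X q s) := by
        refine Real.one_le_exp ?_
        have := softNorm_le (X q s).1
        simp only [hX, Set.mem_Iic] at this hqy ⊢
        nlinarith
      have h2 : 1 ≤ weightSum κ x (X q) := h1.trans
        (Finset.single_le_sum (f := fun s => expWeight κ x (X q s))
          (fun s _ => (expWeight_pos _ _ _).le) (Finset.mem_univ s))
      have h3 : softInd κ x (X q) ≤ Real.exp (-1) := Real.exp_le_exp.2 (by linarith)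
      have h4 : Real.exp (-1) ≤ 1 / 2 := by
        rw [Real.exp_neg, one_div]
        exact inv_anti₀ two_pos (by linarith [Real.add_one_le_exp (1 : ℝ)])
      linarith
    · rw [Set.indicator_of_notMem hq]
      linarith [softInd_le_one κ x (X q)]
  have iE : Integrable (fun g : Fin m → ℝ => Real.exp (-c * ‖WithLp.toLp 2 g‖))
      (stdGauss (Fin m)) := by
    refine Integrable.of_bound (Continuous.aestronglyMeasurable (by fun_prop)) 1
      (Filter.Eventually.of_forall fun g => ?_)
    rw [Real.norm_eq_abs, Real.abs_exp, Real.exp_le_one_iff]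
    nlinarith [norm_nonneg (WithLp.toLp 2 g)]
  -- Each weight is at most `exp ((c x - c ‖g‖ + R h) / p)`, so `S ^ p ≤ N ^ p * exp (c x - c ‖g‖ +
  -- R h)`, and independence of `g` and `h` factors the integral.
  have hup : 1 - ∫ p, softInd κ x (Y p) ∂Q ≤ Real.exp 1 * Real.exp (c * x) *
      ((∫ g, Real.exp (-c * ‖WithLp.toLp 2 g‖) ∂(stdGauss (Fin m))) *
        ∫ h, Real.exp (R h) ∂(stdGauss (Fin n))) := by
    have e2 : 1 - ∫ p, softInd κ x (Y p) ∂Q = ∫ p, (1 - softInd κ x (Y p)) ∂Q := by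
      rw [integral_sub (integrable_const _) iY]
      simp
    rw [e2, ← integral_prod_mul, ← integral_const_mul]
    refine integral_mono ((integrable_const _).sub iY) ((iE.mul_prod hRi).const_mul _) fun q => ?_
    have hS0 := weightSum_nonneg κ x (Y q)
    refine (one_sub_exp_neg_le_rpow hS0 hp0.le hp1).trans ?_
    have hS : weightSum κ x (Y q)
        ≤ N * Real.exp ((c * x - c * ‖WithLp.toLp 2 q.1‖ + R q.2) / p) := by
      have : ∀ s, expWeight κ x (Y q s)
          ≤ Real.exp ((c * x - c * ‖WithLp.toLp 2 q.1‖ + R q.2) / p) := by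
        intro s
        refine Real.exp_le_exp.2 ?_
        rw [le_div_iff₀ hp0]
        have h1 : -κ * (softNorm (Y q s).1 + (Y q s).2 - x) * p
            = c * x - c * softNorm (Y q s).1 + -(c * (Y q s).2) := by
          rw [hκ]; field_simp; ring
        rw [h1]
        have h2 := mul_le_mul_of_nonneg_left (norm_le_softNorm (Y q s).1) hc.le
        have h3 := hR s q.2
        simp only [hY] at h2 h3 ⊢
        linarith
      calc weightSum κ x (Y q) ≤ ∑ _s : J,
            Real.exp ((c * x - c * ‖WithLp.toLp 2 q.1‖ + R q.2) / p) :=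
          Finset.sum_le_sum fun s _ => this s
        _ = _ := by simp [hN]
    refine (Real.rpow_le_rpow hS0 hS hp0.le).trans ?_
    rw [Real.mul_rpow hN0 (Real.exp_pos _).le, ← Real.exp_mul, div_mul_cancel₀ _ hp0.ne',
      mul_assoc, ← Real.exp_add, ← Real.exp_add]
    exact mul_le_mul hNp (Real.exp_le_exp.2 (by linarith)) (Real.exp_pos _).le (Real.exp_pos _).le
  nlinarith

end

/-! ### The cone of possible error vectors -/

/-- Unit vectors whose `ℓ₁` norm is concentrated on at most `k` coordinates. -/
def coneSet (n k : ℕ) : Set (Fin n → ℝ) :=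
  {w | ∑ j, w j ^ 2 = 1 ∧ ∃ K : Finset (Fin n), K.card ≤ k ∧ ∑ j ∈ Kᶜ, |w j| ≤ ∑ j ∈ K, |w j|}

lemma exists_mem_coneSet_of_not_recoversAll {m n k : ℕ} {A : Matrix (Fin m) (Fin n) ℝ}
    (h : ¬ RecoversAll A k) : ∃ w ∈ coneSet n k, A.mulVec w = 0 := by
  simp only [RecoversAll, IsL1Solution, not_forall, not_lt] at h
  obtain ⟨x, hx, z, hz, hne, hle⟩ := h
  have hpos : 0 < ∑ j, (z j - x j) ^ 2 := by
    obtain ⟨j, hj⟩ := Function.ne_iff.1 hne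
    exact Finset.sum_pos' (fun _ _ => sq_nonneg _)
      ⟨j, Finset.mem_univ j, by have := sub_ne_zero.2 hj; positivity⟩
  set r := Real.sqrt (∑ j, (z j - x j) ^ 2) with hr
  have hr0 : 0 < r := Real.sqrt_pos.2 hpos
  -- The witness is the normalized error of a competitor `z`. Since `‖z‖₁ ≤ ‖x‖₁`, its mass off the
  -- support of `x` is at most its mass on it.
  refine ⟨r⁻¹ • (z - x), ⟨?_, Finset.univ.filter fun i => x i ≠ 0, hx, ?_⟩, ?_⟩
  · simp only [Pi.smul_apply, Pi.sub_apply, smul_eq_mul, mul_pow, ← Finset.mul_sum]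
    rw [inv_pow, hr, Real.sq_sqrt hpos.le, inv_mul_cancel₀ hpos.ne']
  · simp only [Pi.smul_apply, Pi.sub_apply, smul_eq_mul, abs_mul, ← Finset.mul_sum]
    refine mul_le_mul_of_nonneg_left ?_ (abs_nonneg _)
    set K := Finset.univ.filter fun i => x i ≠ 0 with hK
    rw [← Finset.sum_add_sum_compl K, ← Finset.sum_add_sum_compl K fun i => |x i|] at hle
    have h1 : ∑ i ∈ Kᶜ, |x i| = 0 := Finset.sum_eq_zero fun i hi => by
      simp only [hK, Finset.mem_compl, Finset.mem_filter, Finset.mem_univ, true_and,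
        not_not] at hi
      simp [hi]
    have h2 : ∑ i ∈ Kᶜ, |z i - x i| = ∑ i ∈ Kᶜ, |z i| := Finset.sum_congr rfl fun i hi => by
      simp only [hK, Finset.mem_compl, Finset.mem_filter, Finset.mem_univ, true_and,
        not_not] at hi
      simp [hi]
    have h3 : ∑ i ∈ K, |x i| - ∑ i ∈ K, |z i| ≤ ∑ i ∈ K, |z i - x i| := by
      rw [← Finset.sum_sub_distrib]
      refine Finset.sum_le_sum fun i _ => ?_
      rw [abs_sub_comm (z i)]
      exact abs_sub_abs_le_abs_sub _ _
    linarith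
  · rw [Matrix.mulVec_smul, Matrix.mulVec_sub, hz, sub_self, smul_zero]

/-- A bound for all finite subsets of the cone bounds the failure probability. -/
lemma measure_not_recoversAll_le {m n k : ℕ} (b : ENNReal)
    (h : ∀ (N : ℕ) (w : Fin N → Fin n → ℝ), (∀ s, w s ∈ coneSet n k) →
      gaussianEntries m n {A | ∃ s, ‖WithLp.toLp 2 ((Matrix.of A).mulVec (w s))‖ < 1} ≤ b) :
    gaussianEntries m n {A | ¬ RecoversAll (Matrix.of A) k} ≤ b := by
  rcases (coneSet n k).eq_empty_or_nonempty with he | hne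
  · have : {A : Fin m → Fin n → ℝ | ¬ RecoversAll (Matrix.of A) k} = ∅ := by
      refine Set.eq_empty_of_forall_notMem fun A hA => ?_
      obtain ⟨w, hw, -⟩ := exists_mem_coneSet_of_not_recoversAll hA
      simp [he] at hw
    rw [this]
    simp
  have : Nonempty (coneSet n k) := hne.to_subtype
  -- If `A w = 0`, the neighbourhood `{v | ‖A v‖ < 1}` of `w` meets the dense sequence, so failure
  -- lies in the increasing union of the events `B N`.
  let d : ℕ → coneSet n k := TopologicalSpace.denseSeq _
  let B : ℕ → Set (Fin m → Fin n → ℝ) := fun N =>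
    {A | ∃ s : Fin N, ‖WithLp.toLp 2 ((Matrix.of A).mulVec (d s).1)‖ < 1}
  have hB : Monotone B := by
    rintro N N' hN A ⟨s, hs⟩
    exact ⟨Fin.castLE hN s, hs⟩
  have hsub : {A : Fin m → Fin n → ℝ | ¬ RecoversAll (Matrix.of A) k} ⊆ ⋃ N, B N := by
    intro A hA
    obtain ⟨w, hw, hAw⟩ := exists_mem_coneSet_of_not_recoversAll hA
    have ho : IsOpen {v : coneSet n k | ‖WithLp.toLp 2 ((Matrix.of A).mulVec v.1)‖ < 1} := by
      refine isOpen_lt ?_ continuous_const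
      fun_prop
    obtain ⟨v, hv, N, rfl⟩ := (TopologicalSpace.denseRange_denseSeq (coneSet n k)).inter_open_nonempty
      _ ho ⟨⟨w, hw⟩, by simp [hAw]⟩
    exact Set.mem_iUnion.2 ⟨N + 1, ⟨N, Nat.lt_succ_self N⟩, hv⟩
  refine (measure_mono hsub).trans ?_
  rw [hB.measure_iUnion]
  exact iSup_le fun N => h N _ fun s => (d s).2

/-! ### Lagrangian duality for the width of the cone -/

lemma mul_sub_mul_sq_le {γ : ℝ} (hγ : 0 < γ) (a u : ℝ) : a * u - γ * u ^ 2 ≤ a ^ 2 / (4 * γ) := by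
  rw [le_div_iff₀ (by positivity)]
  nlinarith [sq_nonneg (a - 2 * γ * u)]

/-- One-coordinate Lagrangian for an index in the distinguished set `K`: `ν₁` is the multiplier of
the cone constraint, `ν₂` that of the cardinality, `γ` that of the norm. -/
lemma le_tStr_add {γ ν₁ ν₂ : ℝ} (hγ : 0 < γ) (h u : ℝ) :
    |h| * u + (ν₁ * u - ν₂) - γ * u ^ 2 ≤ tStr γ ν₁ ν₂ h := by
  have h1 := mul_sub_mul_sq_le hγ (|h| + ν₁) u
  have h2 : (|h| + ν₁) ^ 2 / (4 * γ) = (h ^ 2 + ν₁ ^ 2) / (4 * γ) + |h| * ν₁ / (2 * γ) := by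
    rw [← sq_abs h]; field_simp; ring
  unfold tStr
  split_ifs
  · have := le_abs_self (|h| * ν₁ / (2 * γ) - ν₂)
    linarith
  · refine le_trans ?_ (le_max_left _ _)
    linarith

/-- The same Lagrangian for an index outside `K`. When `|h| < ν₁` the vertex of the parabola is at a
negative `u`, so over `u ≥ 0` the maximum is `ν₂`, taken at `u = 0`; this is the truncation in the
definition of `t`. -/
lemma le_tStr_sub {γ ν₁ ν₂ : ℝ} (hγ : 0 < γ) (h : ℝ) {u : ℝ} (hu : 0 ≤ u) :
    |h| * u - (ν₁ * u - ν₂) - γ * u ^ 2 ≤ tStr γ ν₁ ν₂ h := by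
  have h1 := mul_sub_mul_sq_le hγ (|h| - ν₁) u
  have h2 : (|h| - ν₁) ^ 2 / (4 * γ) = (h ^ 2 + ν₁ ^ 2) / (4 * γ) - |h| * ν₁ / (2 * γ) := by
    rw [← sq_abs h]; field_simp; ring
  unfold tStr
  split_ifs with hh
  · have := neg_abs_le (|h| * ν₁ / (2 * γ) - ν₂)
    linarith
  · refine le_trans ?_ (le_max_right _ _)
    push Not at hh
    nlinarith [mul_nonneg hu (sub_nonneg.2 hh.le), mul_nonneg hγ.le (sq_nonneg u)]

/-- The Lagrangian bound for the width of the cone. -/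
lemma sqrt_mul_sum_le {n k : ℕ} {γ ν₁ ν₂ : ℝ} (hγ : 0 < γ) (h₁ : 0 ≤ ν₁) (h₂ : 0 ≤ ν₂)
    {w : Fin n → ℝ} (hw : w ∈ coneSet n k) (h : Fin n → ℝ) :
    -(Real.sqrt n * ∑ j, h j * w j) ≤ n * γ + ν₂ * (2 * k - n) + ∑ j, tStr γ ν₁ ν₂ (h j) := by
  obtain ⟨hw1, K, hK, hle⟩ := hw
  -- With this scaling `∑ u² = n`, so the norm multiplier costs `n * γ`. The `ν₁` terms sum to
  -- something nonnegative by the cone condition, and the `ν₂` terms to `ν₂ * (n - 2 * K.card)`.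
  set u : Fin n → ℝ := fun j => Real.sqrt n * |w j| with hu
  have hu0 : ∀ j, 0 ≤ u j := fun j => by positivity
  have h0 : -(Real.sqrt n * ∑ j, h j * w j) ≤ ∑ j, |h j| * u j := by
    rw [Finset.mul_sum, ← Finset.sum_neg_distrib]
    refine Finset.sum_le_sum fun j _ => ?_
    calc -(Real.sqrt n * (h j * w j)) ≤ |-(Real.sqrt n * (h j * w j))| := le_abs_self _
      _ = |h j| * u j := by
        rw [abs_neg, abs_mul, abs_mul, abs_of_nonneg (Real.sqrt_nonneg _)]; simp only [hu]; ring
  have hsq : ∑ j, u j ^ 2 = n := by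
    simp only [hu, mul_pow, sq_abs, ← Finset.mul_sum, hw1, mul_one]
    exact Real.sq_sqrt (Nat.cast_nonneg n)
  have hKu : ∑ j ∈ Kᶜ, u j ≤ ∑ j ∈ K, u j := by
    simp only [hu, ← Finset.mul_sum]
    exact mul_le_mul_of_nonneg_left hle (Real.sqrt_nonneg _)
  have e1 : ∑ j ∈ K, (|h j| * u j + (ν₁ * u j - ν₂) - γ * u j ^ 2)
      ≤ ∑ j ∈ K, tStr γ ν₁ ν₂ (h j) := Finset.sum_le_sum fun j _ => le_tStr_add hγ _ _
  have e2 : ∑ j ∈ Kᶜ, (|h j| * u j - (ν₁ * u j - ν₂) - γ * u j ^ 2)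
      ≤ ∑ j ∈ Kᶜ, tStr γ ν₁ ν₂ (h j) := Finset.sum_le_sum fun j _ => le_tStr_sub hγ _ (hu0 j)
  simp only [Finset.sum_add_distrib, Finset.sum_sub_distrib, Finset.sum_const,
    ← Finset.mul_sum, nsmul_eq_mul] at e1 e2
  have s1 := Finset.sum_add_sum_compl K fun j => |h j| * u j
  have s2 := Finset.sum_add_sum_compl K fun j => u j ^ 2
  have s3 := Finset.sum_add_sum_compl K fun j => tStr γ ν₁ ν₂ (h j)
  have s4 : ((Kᶜ).card : ℝ) = n - K.card := by
    rw [Finset.card_compl, Fintype.card_fin, Nat.cast_sub (by simpa using K.card_le_univ)]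
  have s5 : (K.card : ℝ) ≤ k := by exact_mod_cast hK
  rw [s4] at e2
  have t1 := mul_le_mul_of_nonneg_left hKu h₁
  have t2 := mul_le_mul_of_nonneg_left s5 h₂
  have t3 : γ * ∑ j ∈ K, u j ^ 2 + γ * ∑ j ∈ Kᶜ, u j ^ 2 = γ * n := by
    rw [← mul_add, s2, hsq]
  linarith

/-! ### The Laplace transform of the norm of a Gaussian vector -/

lemma integral_exp_neg_mul_sq_gaussianReal {a : ℝ} (ha : 0 ≤ a) :
    ∫ x, Real.exp (-a * x ^ 2) ∂(gaussianReal 0 1) = Real.exp (-(Real.log (1 + 2 * a) / 2)) := by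
  have h0 : 0 < 1 + 2 * a := by positivity
  rw [integral_gaussianReal_eq_integral_smul one_ne_zero]
  have h1 : ∀ x : ℝ, gaussianPDFReal 0 1 x • Real.exp (-a * x ^ 2)
      = (Real.sqrt (2 * Real.pi))⁻¹ * Real.exp (-(a + 1 / 2) * x ^ 2) := by
    intro x
    simp only [gaussianPDFReal, NNReal.coe_one, mul_one, smul_eq_mul, sub_zero]
    rw [mul_assoc, ← Real.exp_add]
    congr 2
    ring
  simp_rw [h1]
  rw [integral_const_mul, integral_gaussian, ← Real.sqrt_inv,
    ← Real.sqrt_mul (by positivity), Real.exp_neg, Real.exp_half, Real.exp_log h0, ← Real.sqrt_inv]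
  congr 1
  have := Real.pi_pos.ne'
  field_simp
  ring

lemma norm_toLp_sq {m : ℕ} (g : Fin m → ℝ) : ‖WithLp.toLp 2 g‖ ^ 2 = ∑ i, g i ^ 2 := by
  rw [EuclideanSpace.norm_sq_eq]
  simp

lemma exp_neg_mul_norm_sq {m : ℕ} (a : ℝ) (g : Fin m → ℝ) :
    Real.exp (-a * ‖WithLp.toLp 2 g‖ ^ 2) = ∏ i, Real.exp (-a * g i ^ 2) := by
  rw [norm_toLp_sq, Finset.mul_sum, Real.exp_sum]

lemma integral_exp_neg_mul_norm_sq {m : ℕ} {a : ℝ} (ha : 0 ≤ a) :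
    ∫ g, Real.exp (-a * ‖WithLp.toLp 2 g‖ ^ 2) ∂(stdGauss (Fin m))
      = Real.exp (-(m * (Real.log (1 + 2 * a) / 2))) := by
  simp_rw [exp_neg_mul_norm_sq]
  unfold stdGauss
  rw [integral_fintype_prod_eq_prod (fun _ x => Real.exp (-a * x ^ 2))]
  simp only [integral_exp_neg_mul_sq_gaussianReal ha, Finset.prod_const, Finset.card_univ,
    Fintype.card_fin, ← Real.exp_nat_mul]
  congr 1
  ring

/-- `γ̂` is the critical point, so that `I_sph` dominates the dual objective at every `γ > 0`. -/
lemma le_Isph {c α γ : ℝ} (hc : 0 < c) (hα : 0 < α) (hγ : 0 < γ) :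
    -γ - α / (2 * c) * Real.log (1 + c / (2 * γ)) ≤ Isph c α := by
  set γ₀ := -gammaSph c α with hγ₀
  have hsq := Real.sq_sqrt (show 0 ≤ 4 * c ^ 2 + 16 * α by positivity)
  have hlt : 2 * c < Real.sqrt (4 * c ^ 2 + 16 * α) := by
    apply Real.lt_sqrt_of_sq_lt; nlinarith
  have hpos : 0 < γ₀ := by rw [hγ₀, gammaSph]; linarith
  -- The critical-point equation of the dual objective; `γ₀` is its positive root.
  have hα' : α = 2 * γ₀ * (2 * γ₀ + c) := by rw [hγ₀, gammaSph]; linarith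
  have hI : Isph c α = -γ₀ - α / (2 * c) * Real.log (1 + c / (2 * γ₀)) := by
    have : gammaSph c α = -γ₀ := by rw [hγ₀, neg_neg]
    rw [Isph, this]
    congr 4
    rw [mul_neg, div_neg, sub_neg_eq_add]
  rw [hI]
  have hl : Real.log (1 + c / (2 * γ₀)) - Real.log (1 + c / (2 * γ))
      ≤ c * (γ - γ₀) / (γ₀ * (2 * γ + c)) := by
    rw [← Real.log_div (by positivity) (by positivity)]
    refine (Real.log_le_sub_one_of_pos (by positivity)).trans (le_of_eq ?_)
    field_simp
    ring
  have h2 := mul_le_mul_of_nonneg_left hl (show 0 ≤ α / (2 * c) by positivity)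
  have h3 : α / (2 * c) * (c * (γ - γ₀) / (γ₀ * (2 * γ + c)))
      = (2 * γ₀ + c) * (γ - γ₀) / (2 * γ + c) := by
    rw [hα']; field_simp
  have h4 : (2 * γ₀ + c) * (γ - γ₀) / (2 * γ + c) ≤ γ - γ₀ := by
    rw [div_le_iff₀ (by positivity)]
    nlinarith [sq_nonneg (γ - γ₀)]
  linarith

/-- With `ρ = r / (2 √n)`, one has `2ρ = min_γ (γ + ρ² / γ)`. Taking for `γ` the grid point of step
`ε` just above `ρ` loses `(γ - ρ)² / γ ≤ ε`, since `γ - ρ ≤ ε ≤ γ`. Values of `ρ` beyond the grid go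
into the last term. The norm is thus replaced by finitely many squared norms, whose Laplace
transforms are explicit. -/
lemma exp_neg_norm_le_sum {c ε : ℝ} (hc : 0 < c) (hε : 0 < ε) (N : ℕ) {n : ℕ} (hn : 0 < n)
    {r : ℝ} (hr : 0 ≤ r) :
    Real.exp (-(c * Real.sqrt n) * r) ≤
      ∑ j ∈ Finset.range N, Real.exp (c * n * (ε - (j + 1) * ε)) *
          Real.exp (-(c / (4 * ((j + 1) * ε))) * r ^ 2)
        + Real.exp (-(2 * c * n * (N * ε))) := by
  have hn0 : (0 : ℝ) < n := by exact_mod_cast hn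
  have hs := Real.sqrt_pos.2 hn0
  have hsq := Real.sq_sqrt hn0.le
  set ρ := r / (2 * Real.sqrt n) with hρ
  have hρ0 : 0 ≤ ρ := by positivity
  have hrρ : r = 2 * Real.sqrt n * ρ := by rw [hρ]; field_simp
  rcases lt_or_ge ρ (N * ε) with h | h
  · set j := ⌊ρ / ε⌋₊ with hj
    have hj1 : (j : ℝ) ≤ ρ / ε := Nat.floor_le (by positivity)
    have hj2 : ρ / ε < j + 1 := Nat.lt_floor_add_one _
    rw [le_div_iff₀ hε] at hj1
    rw [div_lt_iff₀ hε] at hj2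
    have hjN : j < N := by
      have : (j : ℝ) < N := by
        by_contra hcon
        push Not at hcon
        nlinarith
      exact_mod_cast this
    refine le_trans ?_ (le_add_of_nonneg_right (Real.exp_pos _).le)
    refine le_trans ?_ (Finset.single_le_sum (f := fun j : ℕ =>
      Real.exp (c * n * (ε - (j + 1) * ε)) * Real.exp (-(c / (4 * ((j + 1) * ε))) * r ^ 2))
      (fun _ _ => by positivity) (Finset.mem_range.2 hjN))
    rw [← Real.exp_add]
    refine Real.exp_le_exp.2 ?_
    set γ : ℝ := (j + 1) * ε with hγ
    have hγ0 : 0 < γ := by positivity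
    have e1 : -(c * Real.sqrt n) * r = -(2 * c * n * ρ) := by
      rw [hrρ, ← hsq]; ring_nf; rw [Real.sqrt_sq hs.le]
    have e2 : -(c / (4 * γ)) * r ^ 2 = -(c * n * (ρ ^ 2 / γ)) := by
      rw [hrρ, mul_pow, mul_pow, hsq]; field_simp; ring
    rw [e1, e2]
    have key : γ + ρ ^ 2 / γ - 2 * ρ ≤ ε := by
      have : γ + ρ ^ 2 / γ - 2 * ρ = (γ - ρ) ^ 2 / γ := by field_simp; ring
      rw [this, div_le_iff₀ hγ0]
      have a1 : 0 ≤ γ - ρ := by linarith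
      have a2 : γ - ρ ≤ ε := by rw [hγ]; linarith
      have a3 : ε ≤ γ := by rw [hγ]; nlinarith [(Nat.cast_nonneg j : (0 : ℝ) ≤ j)]
      nlinarith
    nlinarith [mul_le_mul_of_nonneg_left key (mul_pos hc hn0).le]
  · refine le_trans (Real.exp_le_exp.2 ?_)
      (le_add_of_nonneg_left (Finset.sum_nonneg fun _ _ => by positivity))
    have e1 : -(c * Real.sqrt n) * r = -(2 * c * n * ρ) := by
      rw [hrρ, ← hsq]; ring_nf; rw [Real.sqrt_sq hs.le]
    rw [e1]
    have := mul_le_mul_of_nonneg_left h (show 0 ≤ 2 * c * n by positivity)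
    linarith

/-- The sphere term `I_sph` bounds the Laplace transform of the norm of a Gaussian vector. -/
lemma integral_exp_neg_norm_le {c α ε : ℝ} (hc : 0 < c) (hα : 0 < α) (hε : 0 < ε) :
    ∃ C : ℝ, 0 < C ∧ ∀ n m : ℕ, 0 < n → α * n - 1 ≤ m →
      ∫ g, Real.exp (-(c * Real.sqrt n) * ‖WithLp.toLp 2 g‖) ∂(stdGauss (Fin m))
        ≤ C * Real.exp (c * n * (Isph c α + ε)) := by
  -- The grid is long enough for the remainder `exp (-2 c n N ε)` to be below the target, and its
  -- length is independent of `n`. Rounding `m` down from `α n` by at most one costs the factors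
  -- `exp (L j)`.
  obtain ⟨N, hN⟩ := exists_nat_gt (-(Isph c α + ε) / (2 * ε))
  rw [div_lt_iff₀ (by positivity)] at hN
  let L : ℕ → ℝ := fun j => Real.log (1 + c / (2 * ((j + 1) * ε))) / 2
  have hL : ∀ j, 0 ≤ L j := fun j => by
    refine div_nonneg (Real.log_nonneg ?_) zero_le_two
    have : 0 ≤ c / (2 * ((j + 1) * ε)) := by positivity
    linarith
  refine ⟨∑ j ∈ Finset.range N, Real.exp (L j) + 1, by positivity, fun n m hn hm => ?_⟩
  have hn0 : (0 : ℝ) < n := by exact_mod_cast hn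
  have hint : ∀ j : ℕ, Integrable (fun g : Fin m → ℝ =>
      Real.exp (c * n * (ε - (j + 1) * ε)) *
        Real.exp (-(c / (4 * ((j + 1) * ε))) * ‖WithLp.toLp 2 g‖ ^ 2)) (stdGauss (Fin m)) := by
    intro j
    refine Integrable.const_mul (Integrable.of_bound (Continuous.aestronglyMeasurable (by fun_prop))
      1 (Filter.Eventually.of_forall fun g => ?_)) _
    rw [Real.norm_eq_abs, Real.abs_exp, Real.exp_le_one_iff, neg_mul]
    exact neg_nonpos.2 (by positivity)
  calc ∫ g, Real.exp (-(c * Real.sqrt n) * ‖WithLp.toLp 2 g‖) ∂(stdGauss (Fin m))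
      ≤ ∫ g, (∑ j ∈ Finset.range N, Real.exp (c * n * (ε - (j + 1) * ε)) *
          Real.exp (-(c / (4 * ((j + 1) * ε))) * ‖WithLp.toLp 2 g‖ ^ 2)
        + Real.exp (-(2 * c * n * (N * ε)))) ∂(stdGauss (Fin m)) := by
        refine integral_mono_of_nonneg (Filter.Eventually.of_forall fun g => (Real.exp_pos _).le)
          ((integrable_finsetSum _ fun j _ => hint j).add (integrable_const _))
          (Filter.Eventually.of_forall fun g => exp_neg_norm_le_sum hc hε N hn (norm_nonneg _))
    _ = ∑ j ∈ Finset.range N, Real.exp (c * n * (ε - (j + 1) * ε)) * Real.exp (-(m * L j))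
        + Real.exp (-(2 * c * n * (N * ε))) := by
        rw [integral_add (integrable_finsetSum _ fun j _ => hint j) (integrable_const _),
          integral_finsetSum _ fun j _ => hint j]
        congr 1
        · refine Finset.sum_congr rfl fun j _ => ?_
          rw [integral_const_mul, integral_exp_neg_mul_norm_sq (by positivity)]
          congr 6
          field_simp
          ring
        · simp
    _ ≤ ∑ j ∈ Finset.range N, Real.exp (L j) * Real.exp (c * n * (Isph c α + ε))
        + 1 * Real.exp (c * n * (Isph c α + ε)) := by
        refine add_le_add (Finset.sum_le_sum fun j _ => ?_) ?_
        · rw [← Real.exp_add, ← Real.exp_add]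
          refine Real.exp_le_exp.2 ?_
          have h1 := le_Isph (γ := (j + 1) * ε) hc hα (by positivity)
          have h2 := mul_le_mul_of_nonneg_left h1 (mul_pos hc hn0).le
          have h3 : c * n * (α / (2 * c) * Real.log (1 + c / (2 * ((j + 1) * ε))))
              = α * n * L j := by
            simp only [L]; field_simp
          have h4 := mul_le_mul_of_nonneg_right hm (hL j)
          rw [mul_sub, h3] at h2
          linarith
        · rw [one_mul]
          refine Real.exp_le_exp.2 ?_
          nlinarith [mul_pos hc hn0]
    _ = _ := by rw [add_mul, Finset.sum_mul]

/-! ### The closed form of the expectation -/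

lemma hasDerivAt_erf (x : ℝ) :
    HasDerivAt erf (2 / Real.sqrt Real.pi * Real.exp (-x ^ 2)) x := by
  have hc : Continuous fun s : ℝ => Real.exp (-s ^ 2) := by fun_prop
  exact (hc.integral_hasStrictDerivAt 0 x).hasDerivAt.const_mul _

lemma erf_zero : erf 0 = 0 := by simp [erf]

lemma tendsto_erf_atTop : Filter.Tendsto erf Filter.atTop (nhds 1) := by
  have hi : Integrable fun s : ℝ => Real.exp (-s ^ 2) := by
    simpa using integrable_exp_neg_mul_sq one_pos
  have h := intervalIntegral_tendsto_integral_Ioi (0 : ℝ) hi.integrableOn Filter.tendsto_id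
  have h2 : ∫ s in Set.Ioi (0 : ℝ), Real.exp (-s ^ 2) = Real.sqrt Real.pi / 2 := by
    simpa using integral_gaussian_Ioi 1
  rw [h2] at h
  have h3 := h.const_mul (2 / Real.sqrt Real.pi)
  have h4 : 2 / Real.sqrt Real.pi * (Real.sqrt Real.pi / 2) = 1 := by
    have := (Real.sqrt_pos.2 Real.pi_pos).ne'
    field_simp
  rw [h4] at h3
  exact h3

/-! ### Gaussian integrals of exponentials of quadratics -/

section Quadratic

variable {p q r s e : ℝ}

/-- Completing the square. In the application `s > 0` holds because `γ > c / 2`. -/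
lemma gaussianPDFReal_mul_exp_quadratic (hs2 : s ^ 2 = 1 / 2 - p) (he : 2 * s * e = q) (x : ℝ) :
    gaussianPDFReal 0 1 x * Real.exp (p * x ^ 2 + q * x + r)
      = (Real.sqrt (2 * Real.pi))⁻¹ * Real.exp (e ^ 2 + r) * Real.exp (-(s * x - e) ^ 2) := by
  simp only [gaussianPDFReal, NNReal.coe_one, mul_one, sub_zero]
  rw [mul_assoc, mul_assoc, ← Real.exp_add, ← Real.exp_add]
  congr 2
  have hp : p = 1 / 2 - s ^ 2 := by linarith
  rw [hp, ← he]
  ring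

lemma integrable_gaussianPDFReal_mul_exp_quadratic (hs : 0 < s) (hs2 : s ^ 2 = 1 / 2 - p)
    (he : 2 * s * e = q) :
    Integrable fun x => gaussianPDFReal 0 1 x * Real.exp (p * x ^ 2 + q * x + r) := by
  simp_rw [gaussianPDFReal_mul_exp_quadratic hs2 he]
  have h := ((integrable_exp_neg_mul_sq one_pos).comp_sub_right e).comp_mul_left' hs.ne'
  simpa using h.const_mul _

lemma hasDerivAt_erf_affine (hs : 0 < s) (hs2 : s ^ 2 = 1 / 2 - p) (he : 2 * s * e = q) (x : ℝ) :
    HasDerivAt (fun x => Real.exp (e ^ 2 + r) / s / 2 / Real.sqrt 2 * erf (s * x - e))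
      (gaussianPDFReal 0 1 x * Real.exp (p * x ^ 2 + q * x + r)) x := by
  have h1 : HasDerivAt (fun x : ℝ => s * x - e) s x := by
    simpa using ((hasDerivAt_id x).const_mul s).sub_const e
  refine (((hasDerivAt_erf _).comp x h1).const_mul _).congr_deriv ?_
  rw [gaussianPDFReal_mul_exp_quadratic hs2 he, Real.sqrt_mul zero_le_two]
  have h2 := (Real.sqrt_pos.2 Real.pi_pos).ne'
  have h3 := (Real.sqrt_pos.2 (zero_lt_two' ℝ)).ne'
  field_simp

lemma integral_quadratic_Ioi (hs : 0 < s) (hs2 : s ^ 2 = 1 / 2 - p) (he : 2 * s * e = q) (a : ℝ) :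
    ∫ x in Set.Ioi a, gaussianPDFReal 0 1 x * Real.exp (p * x ^ 2 + q * x + r)
      = Real.exp (e ^ 2 + r) / s / 2 / Real.sqrt 2 * erfc (a * s - e) := by
  have ht : Filter.Tendsto (fun x : ℝ => s * x - e) Filter.atTop Filter.atTop :=
    Filter.tendsto_atTop_add_const_right _ (-e) (Filter.tendsto_id.const_mul_atTop hs)
  rw [integral_Ioi_of_hasDerivAt_of_tendsto' (fun x _ => hasDerivAt_erf_affine hs hs2 he x)
    (integrable_gaussianPDFReal_mul_exp_quadratic hs hs2 he).integrableOn
    ((tendsto_erf_atTop.comp ht).const_mul _), erfc, mul_comm a]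
  ring

lemma integral_quadratic_interval (hs : 0 < s) (hs2 : s ^ 2 = 1 / 2 - p) (he : 2 * s * e = q)
    (a b : ℝ) :
    ∫ x in a..b, gaussianPDFReal 0 1 x * Real.exp (p * x ^ 2 + q * x + r)
      = Real.exp (e ^ 2 + r) / s / 2 / Real.sqrt 2 * (erfc (a * s - e) - erfc (b * s - e)) := by
  rw [intervalIntegral.integral_eq_sub_of_hasDerivAt
    (fun x _ => hasDerivAt_erf_affine hs hs2 he x)
    (integrable_gaussianPDFReal_mul_exp_quadratic hs hs2 he).intervalIntegrable, erfc, erfc,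
    mul_comm a, mul_comm b]
  ring

end Quadratic

lemma integral_const_interval (r b : ℝ) :
    ∫ x in (0 : ℝ)..b, gaussianPDFReal 0 1 x * Real.exp r
      = 1 / 2 * Real.exp r * erf (b / Real.sqrt 2) := by
  have h2 := Real.sqrt_pos.2 (zero_lt_two' ℝ)
  have h := integral_quadratic_interval (p := 0) (q := 0) (r := r) (s := (Real.sqrt 2)⁻¹) (e := 0)
    (by positivity) (by rw [inv_pow, Real.sq_sqrt zero_le_two]; norm_num) (by ring) 0 b
  simp only [zero_mul, zero_add, sub_zero, erfc, erf_zero] at h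
  rw [h, ← div_eq_mul_inv]
  field_simp
  ring_nf

/-- A formula for `t` without case distinction. -/
lemma tStr_eq_max {γ : ℝ} (hγ : 0 < γ) {ν₁ : ℝ} (ν₂ h : ℝ) :
    tStr γ ν₁ ν₂ h = max ((|h| + ν₁) ^ 2 / (4 * γ) - ν₂) (max (|h| - ν₁) 0 ^ 2 / (4 * γ) + ν₂) := by
  unfold tStr
  split_ifs with hh
  · rw [max_eq_left (sub_nonneg.2 hh)]
    have e1 : (|h| + ν₁) ^ 2 / (4 * γ) = (h ^ 2 + ν₁ ^ 2) / (4 * γ) + |h| * ν₁ / (2 * γ) := by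
      rw [← sq_abs h]; field_simp; ring
    have e2 : (|h| - ν₁) ^ 2 / (4 * γ) = (h ^ 2 + ν₁ ^ 2) / (4 * γ) - |h| * ν₁ / (2 * γ) := by
      rw [← sq_abs h]; field_simp; ring
    rw [e1, e2, abs_eq_max_neg, ← max_add_add_left]
    congr 1 <;> ring
  · push Not at hh
    rw [max_eq_right (sub_nonpos.2 hh.le)]
    norm_num

/-! ### Finiteness of the moment and its evaluation piece by piece -/

section Moment

variable {c γ ν₁ ν₂ : ℝ}

lemma sPar_pos (hc : 0 < c) (hγ : c / 2 < γ) : 0 < sPar c γ := by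
  refine Real.sqrt_pos.2 ?_
  have : pPar c γ < 1 / 2 := by
    unfold pPar; rw [div_lt_iff₀ (by linarith)]; linarith
  linarith

lemma sPar_sq (hc : 0 < c) (hγ : c / 2 < γ) : sPar c γ ^ 2 = 1 / 2 - pPar c γ :=
  Real.sq_sqrt (Real.sqrt_pos.1 (sPar_pos hc hγ)).le

lemma two_mul_sPar_mul_ePar (hc : 0 < c) (hγ : c / 2 < γ) (ν₁ : ℝ) :
    2 * sPar c γ * ePar c γ ν₁ = qPar c γ ν₁ := by
  have h : Real.sqrt (2 * (1 - 2 * pPar c γ)) = 2 * sPar c γ := by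
    rw [show 2 * (1 - 2 * pPar c γ) = (2 * sPar c γ) ^ 2 by rw [mul_pow, sPar_sq hc hγ]; ring]
    exact Real.sqrt_sq (by linarith [sPar_pos hc hγ])
  have := (sPar_pos hc hγ).ne'
  rw [ePar, h]
  field_simp

lemma continuous_tStr (hγ : 0 < γ) : Continuous (tStr γ ν₁ ν₂) := by
  rw [funext (tStr_eq_max hγ (ν₁ := ν₁) ν₂)]
  fun_prop

lemma exp_mul_sq_add (hγ : 0 < γ) (x : ℝ) :
    Real.exp (c * ((x + ν₁) ^ 2 / (4 * γ) - ν₂))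
      = Real.exp (pPar c γ * x ^ 2 + qPar c γ ν₁ * x + c * (ν₁ ^ 2 / (4 * γ) - ν₂)) := by
  congr 1
  unfold pPar qPar
  field_simp
  ring

lemma exp_mul_sq_sub (hγ : 0 < γ) (x : ℝ) :
    Real.exp (c * ((x - ν₁) ^ 2 / (4 * γ) + ν₂))
      = Real.exp (pPar c γ * x ^ 2 + -qPar c γ ν₁ * x + c * (ν₁ ^ 2 / (4 * γ) + ν₂)) := by
  congr 1
  unfold pPar qPar
  field_simp
  ring

lemma integrable_pdf_mul_exp_tStr (hc : 0 < c) (hγ : c / 2 < γ) (h₁ : 0 ≤ ν₁) (h₂ : 0 ≤ ν₂) :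
    Integrable fun x => gaussianPDFReal 0 1 x * Real.exp (c * tStr γ ν₁ ν₂ x) := by
  have hγ0 : 0 < γ := by linarith
  have hs := sPar_pos hc hγ
  have i1 := integrable_gaussianPDFReal_mul_exp_quadratic (r := c * (ν₁ ^ 2 / (4 * γ) + ν₂)) hs
    (sPar_sq hc hγ) (two_mul_sPar_mul_ePar hc hγ ν₁)
  -- The majorant has a term in `q |x|`; its exponential is bounded by the sum of those with `q x`
  -- and `-q x`.
  have i2 := integrable_gaussianPDFReal_mul_exp_quadratic (r := c * (ν₁ ^ 2 / (4 * γ) + ν₂)) hs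
    (sPar_sq hc hγ) (e := -ePar c γ ν₁) (q := -qPar c γ ν₁)
    (by rw [← two_mul_sPar_mul_ePar hc hγ]; ring)
  refine (i1.add i2).mono' ((by
    refine (measurable_gaussianPDFReal 0 1).mul ?_
    have := (continuous_tStr (ν₁ := ν₁) (ν₂ := ν₂) hγ0).measurable
    fun_prop : Measurable _).aestronglyMeasurable) (Filter.Eventually.of_forall fun x => ?_)
  have hpdf := gaussianPDFReal_nonneg 0 1 x
  rw [Real.norm_eq_abs, abs_of_nonneg (mul_nonneg hpdf (Real.exp_pos _).le), Pi.add_apply,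
    ← mul_add]
  refine mul_le_mul_of_nonneg_left ?_ hpdf
  have ht : tStr γ ν₁ ν₂ x ≤ (|x| + ν₁) ^ 2 / (4 * γ) + ν₂ := by
    rw [tStr_eq_max hγ0]
    refine max_le (by linarith) ?_
    gcongr
    exact max_le (by linarith) (by positivity)
  have key : ∀ y : ℝ, c * ((y + ν₁) ^ 2 / (4 * γ) + ν₂)
      = pPar c γ * y ^ 2 + qPar c γ ν₁ * y + c * (ν₁ ^ 2 / (4 * γ) + ν₂) := by
    intro y; unfold pPar qPar; field_simp; ring
  have hle := Real.exp_le_exp.2 (mul_le_mul_of_nonneg_left ht hc.le)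
  rw [key] at hle
  refine hle.trans ?_
  rcases abs_cases x with ⟨hx, -⟩ | ⟨hx, -⟩
  · rw [hx]
    exact le_add_of_nonneg_right (Real.exp_pos _).le
  · rw [hx, neg_sq, mul_neg, ← neg_mul]
    exact le_add_of_nonneg_left (Real.exp_pos _).le

/-- The expectation `E exp (c t)` is finite. -/
lemma integrable_exp_tStr (hc : 0 < c) (hγ : c / 2 < γ) (h₁ : 0 ≤ ν₁) (h₂ : 0 ≤ ν₂) :
    Integrable (fun h => Real.exp (c * tStr γ ν₁ ν₂ h)) (gaussianReal 0 1) := by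
  rw [gaussianReal_of_var_ne_zero _ one_ne_zero,
    integrable_withDensity_iff_integrable_smul' (measurable_gaussianPDF _ _)
      (by simp [gaussianPDF])]
  simpa only [toReal_gaussianPDF, smul_eq_mul] using integrable_pdf_mul_exp_tStr hc hγ h₁ h₂

lemma Imoment_eq_two_mul (hγ : 0 < γ) :
    Imoment c γ ν₁ ν₂ =
      2 * ∫ x in Set.Ioi (0 : ℝ), gaussianPDFReal 0 1 x * Real.exp (c * tStr γ ν₁ ν₂ x) := by
  rw [← integral_comp_abs, Imoment, integral_gaussianReal_eq_integral_smul one_ne_zero]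
  refine integral_congr_ae (Filter.Eventually.of_forall fun x => ?_)
  simp only [smul_eq_mul, tStr_eq_max hγ, abs_abs, gaussianPDFReal, sub_zero, sq_abs]

/-- For `x ≤ ν₁` the competitor is the constant `ν₂`, which `hA` handles; for `x ≥ ν₁` the identity
`(x + ν₁)² - (x - ν₁)² = 4 x ν₁` makes `hB` the exact condition. -/
lemma tStr_eq_add (hγ : 0 < γ) {x : ℝ} (hx : 0 ≤ x)
    (hA : 8 * γ * ν₂ ≤ (x + ν₁) ^ 2) (hB : ν₁ ≤ x → 2 * γ * ν₂ ≤ x * ν₁) :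
    tStr γ ν₁ ν₂ x = (x + ν₁) ^ 2 / (4 * γ) - ν₂ := by
  rw [tStr_eq_max hγ, abs_of_nonneg hx]
  refine max_eq_left ?_
  rw [← sub_nonneg]
  have e : (x + ν₁) ^ 2 / (4 * γ) - ν₂ - (max (x - ν₁) 0 ^ 2 / (4 * γ) + ν₂)
      = ((x + ν₁) ^ 2 - max (x - ν₁) 0 ^ 2 - 8 * γ * ν₂) / (4 * γ) := by field_simp; ring
  rw [e]
  refine div_nonneg ?_ (by positivity)
  rcases le_total ν₁ x with h | h
  · rw [max_eq_left (by linarith)]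
    nlinarith [hB h]
  · rw [max_eq_right (by linarith)]
    nlinarith

lemma tStr_eq_sub (hγ : 0 < γ) {x : ℝ} (h₁ : 0 ≤ ν₁) (hx : ν₁ ≤ x) (hB : x * ν₁ ≤ 2 * γ * ν₂) :
    tStr γ ν₁ ν₂ x = (x - ν₁) ^ 2 / (4 * γ) + ν₂ := by
  rw [tStr_eq_max hγ, abs_of_nonneg (h₁.trans hx), max_eq_left (sub_nonneg.2 hx)]
  refine max_eq_right ?_
  rw [← sub_nonneg]
  have e : (x - ν₁) ^ 2 / (4 * γ) + ν₂ - ((x + ν₁) ^ 2 / (4 * γ) - ν₂)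
      = (8 * γ * ν₂ - 4 * (x * ν₁)) / (4 * γ) := by field_simp; ring
  rw [e]
  exact div_nonneg (by linarith) (by positivity)

lemma tStr_eq_const (hγ : 0 < γ) {x : ℝ} (hx : 0 ≤ x) (hx1 : x ≤ ν₁)
    (hA : (x + ν₁) ^ 2 ≤ 8 * γ * ν₂) : tStr γ ν₁ ν₂ x = ν₂ := by
  rw [tStr_eq_max hγ, abs_of_nonneg hx, max_eq_right (sub_nonpos.2 hx1)]
  have : (x + ν₁) ^ 2 / (4 * γ) - ν₂ ≤ ν₂ := by
    rw [sub_le_iff_le_add, div_le_iff₀ (by positivity)]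
    linarith
  rw [max_eq_right (by simpa using this)]
  simp

lemma integral_Ioi_of_tStr_eq_add (hc : 0 < c) (hγ : c / 2 < γ) {a : ℝ}
    (h : ∀ x, a ≤ x → tStr γ ν₁ ν₂ x = (x + ν₁) ^ 2 / (4 * γ) - ν₂) :
    ∫ x in Set.Ioi a, gaussianPDFReal 0 1 x * Real.exp (c * tStr γ ν₁ ν₂ x)
      = C₁ c γ ν₁ ν₂ / 2 / Real.sqrt 2 * erfc (a * sPar c γ - ePar c γ ν₁) := by
  have hγ0 : 0 < γ := by linarith
  rw [C₁, ← integral_quadratic_Ioi (sPar_pos hc hγ) (sPar_sq hc hγ)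
    (two_mul_sPar_mul_ePar hc hγ ν₁) a]
  refine setIntegral_congr_fun measurableSet_Ioi fun x hx => ?_
  simp only [h x (le_of_lt hx), exp_mul_sq_add hγ0]

lemma integral_interval_of_tStr_eq_const {b : ℝ} (hb : 0 ≤ b)
    (h : ∀ x, 0 ≤ x → x ≤ b → tStr γ ν₁ ν₂ x = ν₂) :
    ∫ x in (0 : ℝ)..b, gaussianPDFReal 0 1 x * Real.exp (c * tStr γ ν₁ ν₂ x)
      = 1 / 2 * Real.exp (c * ν₂) * erf (b / Real.sqrt 2) := by
  rw [← integral_const_interval]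
  refine intervalIntegral.integral_congr fun x hx => ?_
  rw [Set.uIcc_of_le hb] at hx
  simp only [h x hx.1 hx.2]

lemma two_mul_sPar_mul_neg_ePar (hc : 0 < c) (hγ : c / 2 < γ) (ν₁ : ℝ) :
    2 * sPar c γ * -ePar c γ ν₁ = -qPar c γ ν₁ := by
  rw [← two_mul_sPar_mul_ePar hc hγ]; ring

lemma integral_Ioi_zero_add (hc : 0 < c) (hγ : c / 2 < γ) (h₁ : 0 ≤ ν₁) (h₂ : 0 ≤ ν₂)
    (a b : ℝ) :
    ∫ x in Set.Ioi a, gaussianPDFReal 0 1 x * Real.exp (c * tStr γ ν₁ ν₂ x)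
      = (∫ x in a..b, gaussianPDFReal 0 1 x * Real.exp (c * tStr γ ν₁ ν₂ x))
        + ∫ x in Set.Ioi b, gaussianPDFReal 0 1 x * Real.exp (c * tStr γ ν₁ ν₂ x) := by
  have hi := integrable_pdf_mul_exp_tStr hc hγ h₁ h₂
  exact (intervalIntegral.integral_interval_add_Ioi hi.integrableOn hi.integrableOn).symm

lemma Imoment_eq_closedI3 (hc : 0 < c) (hγ : c / 2 < γ) (h₁ : 0 ≤ ν₁) (h₂ : 0 ≤ ν₂)
    (h : 8 * γ * ν₂ ≤ ν₁ ^ 2) : Imoment c γ ν₁ ν₂ = closedI3 c γ ν₁ ν₂ := by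
  have hγ0 : 0 < γ := by linarith
  have h0 : 0 ≤ γ * ν₂ := mul_nonneg hγ0.le h₂
  rw [Imoment_eq_two_mul hγ0, integral_Ioi_of_tStr_eq_add hc hγ fun x hx =>
    tStr_eq_add hγ0 hx (by nlinarith [mul_nonneg hx h₁]) fun hx1 => by nlinarith, closedI3]
  ring_nf

lemma Imoment_eq_closedI2 (hc : 0 < c) (hγ : c / 2 < γ) (h₁ : 0 ≤ ν₁) (h₂ : 0 ≤ ν₂)
    (h : 2 * γ * ν₂ ≤ ν₁ ^ 2) (h' : ν₁ ^ 2 < 8 * γ * ν₂) :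
    Imoment c γ ν₁ ν₂ = closedI2 c γ ν₁ ν₂ := by
  have hγ0 : 0 < γ := by linarith
  set z := Real.sqrt (8 * γ * ν₂) - ν₁ with hz
  have hsq : (z + ν₁) ^ 2 = 8 * γ * ν₂ := by
    rw [hz, sub_add_cancel]; exact Real.sq_sqrt (mul_nonneg (by positivity) h₂)
  have hz0 : 0 ≤ z := sub_nonneg.2 (Real.le_sqrt_of_sq_le h'.le)
  -- The additive branch overtakes `ν₂` at `z`, before the subtractive branch leaves its constant
  -- value at `ν₁`; hence only two pieces occur.
  have hz1 : z ≤ ν₁ := by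
    have : Real.sqrt (8 * γ * ν₂) ≤ 2 * ν₁ := Real.sqrt_le_iff.2 ⟨by positivity, by nlinarith⟩
    linarith
  rw [Imoment_eq_two_mul hγ0, integral_Ioi_zero_add hc hγ h₁ h₂ 0 z,
    integral_interval_of_tStr_eq_const hz0 fun x hx0 hx =>
      tStr_eq_const hγ0 hx0 (hx.trans hz1) (by rw [← hsq]; gcongr),
    integral_Ioi_of_tStr_eq_add hc hγ fun x hx =>
      tStr_eq_add hγ0 (hz0.trans hx) (by rw [← hsq]; gcongr) fun hx1 => by nlinarith, closedI2]
  ring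

lemma Imoment_eq_closedI1 (hc : 0 < c) (hγ : c / 2 < γ) (h₁ : 0 ≤ ν₁) (h₂ : 0 ≤ ν₂)
    (h : ν₁ ^ 2 < 2 * γ * ν₂) : Imoment c γ ν₁ ν₂ = closedI1 c γ ν₁ ν₂ := by
  have hγ0 : 0 < γ := by linarith
  have hconst : ∀ x, 0 ≤ x → x ≤ ν₁ → tStr γ ν₁ ν₂ x = ν₂ := fun x hx0 hx =>
    tStr_eq_const hγ0 hx0 hx (by nlinarith)
  rw [Imoment_eq_two_mul hγ0, integral_Ioi_zero_add hc hγ h₁ h₂ 0 ν₁,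
    integral_interval_of_tStr_eq_const h₁ hconst, closedI1]
  rcases h₁.eq_or_lt with h0 | h0
  -- When `ν₁ = 0` the crossing point `2γν₂ / ν₁` is at infinity and the subtractive branch holds on
  -- the whole half-line.
  · subst h0
    have e1 : ∫ x in Set.Ioi (0 : ℝ), gaussianPDFReal 0 1 x * Real.exp (c * tStr γ 0 ν₂ x)
        = C₁₂ c γ 0 ν₂ / 2 / Real.sqrt 2 * erfc (0 * sPar c γ - -ePar c γ 0) := by
      rw [C₁₂, ← integral_quadratic_Ioi (sPar_pos hc hγ) (sPar_sq hc hγ)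
        (two_mul_sPar_mul_neg_ePar hc hγ 0) 0]
      refine setIntegral_congr_fun measurableSet_Ioi fun x hx => ?_
      simp only [tStr_eq_sub hγ0 le_rfl (le_of_lt hx) (by linarith), exp_mul_sq_sub hγ0]
    rw [e1, erfcCross, erfcCross, if_pos rfl, if_pos rfl]
    ring_nf
  · have hb : ν₁ ≤ 2 * γ * ν₂ / ν₁ := by rw [le_div_iff₀ h0]; nlinarith
    have e1 : ∫ x in ν₁..(2 * γ * ν₂ / ν₁),
          gaussianPDFReal 0 1 x * Real.exp (c * tStr γ ν₁ ν₂ x)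
        = C₁₂ c γ ν₁ ν₂ / 2 / Real.sqrt 2 * (erfc (ν₁ * sPar c γ - -ePar c γ ν₁)
          - erfc (2 * γ * ν₂ / ν₁ * sPar c γ - -ePar c γ ν₁)) := by
      rw [C₁₂, ← integral_quadratic_interval (sPar_pos hc hγ) (sPar_sq hc hγ)
        (two_mul_sPar_mul_neg_ePar hc hγ ν₁)]
      refine intervalIntegral.integral_congr fun x hx => ?_
      rw [Set.uIcc_of_le hb] at hx
      have hx2 := (le_div_iff₀ h0).1 hx.2
      simp only [tStr_eq_sub hγ0 h₁ hx.1 hx2, exp_mul_sq_sub hγ0]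
    have e2 := integral_Ioi_of_tStr_eq_add (ν₂ := ν₂) hc hγ (a := 2 * γ * ν₂ / ν₁) fun x hx => by
      have hx2 := (div_le_iff₀ h0).1 hx
      exact tStr_eq_add hγ0 (h₁.trans (hb.trans hx)) (by nlinarith [sq_nonneg (x - ν₁)])
        fun _ => hx2
    rw [integral_Ioi_zero_add hc hγ h₁ h₂ ν₁ (2 * γ * ν₂ / ν₁), e1, e2, erfcCross, erfcCross,
      if_neg h0.ne', if_neg h0.ne', sub_neg_eq_add, sub_neg_eq_add, ← sub_eq_add_neg]
    ring

/-- The closed form of `E exp (c t)`. -/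
theorem Imoment_eq_closedI (hc : 0 < c) (hγ : c / 2 < γ) (h₁ : 0 ≤ ν₁) (h₂ : 0 ≤ ν₂) :
    Imoment c γ ν₁ ν₂ = closedI c γ ν₁ ν₂ := by
  unfold closedI
  split_ifs with h h'
  · exact Imoment_eq_closedI1 hc hγ h₁ h₂ h
  · exact Imoment_eq_closedI2 hc hγ h₁ h₂ (not_lt.1 h) h'
  · exact Imoment_eq_closedI3 hc hγ h₁ h₂ (not_lt.1 h')

end Moment

/-! ### The exponential bound for the failure probability -/

/-- On the unit interval `[-y - 1, -y]` the density is at least its value at the left end. This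
loses only `exp (O(y))` against the true tail. -/
lemma gaussianReal_Iic_neg_ge {y : ℝ} (hy : 0 ≤ y) :
    (Real.sqrt (2 * Real.pi))⁻¹ * Real.exp (-((y + 1) ^ 2 / 2))
      ≤ (gaussianReal 0 1).real (Set.Iic (-y)) := by
  have hi := integrable_gaussianPDFReal 0 1
  have h1 : (gaussianReal 0 1).real (Set.Iic (-y)) = ∫ x in Set.Iic (-y), gaussianPDFReal 0 1 x := by
    rw [Measure.real, gaussianReal_apply_eq_integral _ one_ne_zero, ENNReal.toReal_ofReal]
    exact integral_nonneg fun x => gaussianPDFReal_nonneg 0 1 x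
  rw [h1]
  calc (Real.sqrt (2 * Real.pi))⁻¹ * Real.exp (-((y + 1) ^ 2 / 2))
      = ∫ _x in Set.Icc (-y - 1) (-y),
          (Real.sqrt (2 * Real.pi))⁻¹ * Real.exp (-((y + 1) ^ 2 / 2)) := by
        rw [setIntegral_const]
        simp
    _ ≤ ∫ x in Set.Icc (-y - 1) (-y), gaussianPDFReal 0 1 x := by
        refine setIntegral_mono_on (integrableOn_const (by simp)) hi.integrableOn
          measurableSet_Icc fun x hx => ?_
        simp only [gaussianPDFReal, NNReal.coe_one, mul_one, sub_zero]
        refine mul_le_mul_of_nonneg_left (Real.exp_le_exp.2 ?_) (by positivity)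
        nlinarith [hx.1, hx.2]
    _ ≤ ∫ x in Set.Iic (-y), gaussianPDFReal 0 1 x :=
        setIntegral_mono_set hi.integrableOn
          (Filter.Eventually.of_forall fun x => gaussianPDFReal_nonneg 0 1 x)
          (Filter.Eventually.of_forall fun x hx => hx.2)

section

variable {c γ ν₁ ν₂ : ℝ}

lemma exp_add_mul_sum_tStr {n : ℕ} (a : ℝ) (h : Fin n → ℝ) :
    Real.exp (a + c * ∑ j, tStr γ ν₁ ν₂ (h j))
      = Real.exp a * ∏ j, Real.exp (c * tStr γ ν₁ ν₂ (h j)) := by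
  rw [Real.exp_add, Finset.mul_sum, Real.exp_sum]

lemma Imoment_pos (hc : 0 < c) (hγ : c / 2 < γ) (h₁ : 0 ≤ ν₁) (h₂ : 0 ≤ ν₂) :
    0 < Imoment c γ ν₁ ν₂ :=
  integral_exp_pos (integrable_exp_tStr hc hγ h₁ h₂)

lemma integral_exp_add_mul_sum_tStr (hc : 0 < c) (hγ : c / 2 < γ) (h₁ : 0 ≤ ν₁) (h₂ : 0 ≤ ν₂)
    (n : ℕ) (a : ℝ) :
    ∫ h, Real.exp (a + c * ∑ j, tStr γ ν₁ ν₂ (h j)) ∂(stdGauss (Fin n))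
      = Real.exp (a + n * Real.log (Imoment c γ ν₁ ν₂)) := by
  simp_rw [exp_add_mul_sum_tStr]
  rw [integral_const_mul]
  unfold stdGauss
  rw [integral_fintype_prod_eq_prod (fun _ x => Real.exp (c * tStr γ ν₁ ν₂ x)), Finset.prod_const,
    Finset.card_univ, Fintype.card_fin, Real.exp_add, Real.exp_nat_mul,
    Real.exp_log (Imoment_pos hc hγ h₁ h₂)]
  rfl

lemma integrable_exp_add_mul_sum_tStr (hc : 0 < c) (hγ : c / 2 < γ) (h₁ : 0 ≤ ν₁) (h₂ : 0 ≤ ν₂)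
    (n : ℕ) (a : ℝ) :
    Integrable (fun h => Real.exp (a + c * ∑ j, tStr γ ν₁ ν₂ (h j))) (stdGauss (Fin n)) := by
  simp_rw [exp_add_mul_sum_tStr]
  exact (Integrable.fintype_prod (f := fun _ x => Real.exp (c * tStr γ ν₁ ν₂ x))
    fun _ => integrable_exp_tStr hc hγ h₁ h₂).const_mul _

/-- The failure probability in terms of the width of the cone and the norm of a Gaussian vector. -/
lemma measure_not_recoversAll_le_exp (hc : 0 < c) (hγ : c / 2 < γ) (h₁ : 0 ≤ ν₁) (h₂ : 0 ≤ ν₂)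
    {n m k : ℕ} (hn : 0 < n) :
    gaussianEntries m n {A | ¬ RecoversAll (Matrix.of A) k} ≤ ENNReal.ofReal
      (2 * Real.exp 1 * Real.sqrt (2 * Real.pi) *
        Real.exp ((c * Real.sqrt n + 1) ^ 2 / 2 + c * Real.sqrt n * (3 - c * Real.sqrt n)
          + c * (n * γ + ν₂ * (2 * k - n)) + n * Real.log (Imoment c γ ν₁ ν₂)) *
        ∫ g, Real.exp (-(c * Real.sqrt n) * ‖WithLp.toLp 2 g‖) ∂(stdGauss (Fin m))) := by
  have hs : 0 < Real.sqrt n := Real.sqrt_pos.2 (by exact_mod_cast hn)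
  have hγ0 : 0 < γ := by linarith
  refine measure_not_recoversAll_le _ fun N w hw => ?_
  rw [← ofReal_measureReal]
  refine ENNReal.ofReal_le_ofReal ?_
  -- Choosing the level equal to the lifting parameter, the factor `exp (-y²)` against the tail `exp
  -- (-y² / 2)` leaves `exp (-c² n / 2)`, up to a factor `exp (O(y))`.
  set y := c * Real.sqrt n with hy
  have hy0 : 0 < y := by positivity
  have hG := gordon_lifted (m := m) w (fun s => (hw s).1) hy0 y
    (fun h => c * (n * γ + ν₂ * (2 * k - n)) + c * ∑ j, tStr γ ν₁ ν₂ (h j))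
    (fun s h => by
      have := mul_le_mul_of_nonneg_left (sqrt_mul_sum_le hγ0 h₁ h₂ (hw s) h) hc.le
      rw [hy]
      linarith)
    (integrable_exp_add_mul_sum_tStr hc hγ h₁ h₂ n _)
  rw [integral_exp_add_mul_sum_tStr hc hγ h₁ h₂] at hG
  set E := ∫ g, Real.exp (-y * ‖WithLp.toLp 2 g‖) ∂(stdGauss (Fin m))
  set μ := (gaussianEntries m n).real {A | ∃ s, ‖WithLp.toLp 2 ((Matrix.of A).mulVec (w s))‖ < 1}
  have hμ : 0 ≤ μ := measureReal_nonneg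
  have hG2 := (mul_le_mul_of_nonneg_left (gaussianReal_Iic_neg_ge hy0.le) hμ).trans hG
  have hπ : 0 < Real.sqrt (2 * Real.pi) := Real.sqrt_pos.2 (by positivity)
  have hG3 := mul_le_mul_of_nonneg_right hG2
    (mul_pos hπ (Real.exp_pos ((y + 1) ^ 2 / 2))).le
  have e1 : μ * ((Real.sqrt (2 * Real.pi))⁻¹ * Real.exp (-((y + 1) ^ 2 / 2))) *
      (Real.sqrt (2 * Real.pi) * Real.exp ((y + 1) ^ 2 / 2)) = μ := by
    rw [Real.exp_neg]
    have := (Real.exp_pos ((y + 1) ^ 2 / 2)).ne'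
    field_simp
  rw [e1] at hG3
  refine hG3.trans (le_of_eq ?_)
  rw [add_assoc, add_assoc, Real.exp_add ((y + 1) ^ 2 / 2), Real.exp_add (y * (3 - y))]
  ring

end

/-- If the lifted condition holds, then `ℓ₁`-minimization fails with exponentially small
probability. -/
theorem exists_failure_bound {α β : ℝ} (hα : 0 < α) (hlift : liftedValue α β < 0) :
    ∃ C η : ℝ, 0 < C ∧ 0 < η ∧
      ∀ n m k : ℕ, |(m : ℝ) - α * n| < 1 → |(k : ℝ) - β * n| < 1 →
        gaussianEntries m n {A | ¬ RecoversAll (Matrix.of A) k} ≤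
          ENNReal.ofReal (C * Real.exp (-η * n)) := by
  have hne : {v : ℝ | ∃ c : ℝ, 0 < c ∧ v = -c / 2 + Istr c β + Isph c α}.Nonempty :=
    ⟨_, 1, one_pos, rfl⟩
  obtain ⟨_, ⟨c, hc, rfl⟩, hv⟩ := exists_lt_of_csInf_lt hne hlift
  have hv' : Istr c β < c / 2 - Isph c α := by linarith
  have hne' : {v : ℝ | ∃ γ ν₁ ν₂ : ℝ, c / 2 < γ ∧ 0 ≤ ν₁ ∧ 0 ≤ ν₂ ∧
      v = ν₂ * (2 * β - 1) + γ + 1 / c * Real.log (Imoment c γ ν₁ ν₂)}.Nonempty :=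
    ⟨_, c, 0, 0, by linarith, le_rfl, le_rfl, rfl⟩
  obtain ⟨_, ⟨γ, ν₁, ν₂, hγ, h₁, h₂, rfl⟩, hV⟩ := exists_lt_of_csInf_lt hne' hv'
  set l := Real.log (Imoment c γ ν₁ ν₂) with hl
  set V := -c / 2 + (ν₂ * (2 * β - 1) + γ + 1 / c * l) + Isph c α with hVdef
  have hV0 : V < 0 := by rw [hVdef]; linarith
  -- One `ε` pays for the sphere term and one for the `4 c √n` error, leaving `V + 2ε = V / 2`.
  set ε := -V / 4 with hε
  have hε0 : 0 < ε := by rw [hε]; linarith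
  obtain ⟨C₀, hC₀, hsph⟩ := integral_exp_neg_norm_le hc hα hε0
  -- The bounded part of the exponent: `1/2` from `(y + 1)² / 2`, `2 c ν₂` from `k ≤ β n + 1`, and
  -- `4 c / ε` from `4 c √n ≤ c n ε + 4 c / ε`.
  set D := 2 * Real.exp 1 * Real.sqrt (2 * Real.pi) *
    (C₀ * Real.exp (1 / 2 + 2 * c * ν₂ + 4 * c / ε)) with hD
  have hD0 : 0 < D := by
    have : 0 < Real.sqrt (2 * Real.pi) := Real.sqrt_pos.2 (by positivity)
    positivity
  -- The extra `1` makes the bound trivial at `n = 0`.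
  refine ⟨D + 1, c * (-V) / 2, by positivity, by nlinarith, fun n m k hm hk => ?_⟩
  rcases Nat.eq_zero_or_pos n with rfl | hn
  · refine prob_le_one.trans ?_
    rw [← ENNReal.ofReal_one]
    refine ENNReal.ofReal_le_ofReal ?_
    simp only [Nat.cast_zero, mul_zero, Real.exp_zero, mul_one]
    linarith
  refine (measure_not_recoversAll_le_exp hc hγ h₁ h₂ hn).trans (ENNReal.ofReal_le_ofReal ?_)
  have hn0 : (0 : ℝ) < n := by exact_mod_cast hn
  have hs := Real.sqrt_nonneg (n : ℝ)
  have hsq := Real.sq_sqrt hn0.le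
  have hE := hsph n m hn (by linarith [(abs_lt.1 hm).1])
  set E := ∫ g, Real.exp (-(c * Real.sqrt n) * ‖WithLp.toLp 2 g‖) ∂(stdGauss (Fin m))
  set T := (c * Real.sqrt n + 1) ^ 2 / 2 + c * Real.sqrt n * (3 - c * Real.sqrt n)
    + c * (n * γ + ν₂ * (2 * k - n)) + n * l with hT
  have hexp : T + c * n * (Isph c α + ε)
      ≤ 1 / 2 + 2 * c * ν₂ + 4 * c / ε + -(c * (-V) / 2) * n := by
    have hk' : c * ν₂ * (2 * k) ≤ c * ν₂ * (2 * (β * n + 1)) := by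
      have := (abs_lt.1 hk).2
      refine mul_le_mul_of_nonneg_left (by linarith) (by positivity)
    have hroot : 4 * c * Real.sqrt n ≤ c * n * ε + 4 * c / ε := by
      have h : c * n * ε + 4 * c / ε - 4 * c * Real.sqrt n
          = c * (Real.sqrt n * ε - 2) ^ 2 / ε := by
        nth_rewrite 1 [← hsq]
        field_simp
        ring
      have : 0 ≤ c * (Real.sqrt n * ε - 2) ^ 2 / ε := by positivity
      linarith
    have hT' : T = 1 / 2 + 4 * c * Real.sqrt n - c ^ 2 * n / 2
        + c * n * γ + c * ν₂ * (2 * k) - c * ν₂ * n + n * l := by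
      have : c ^ 2 * n = c ^ 2 * Real.sqrt n ^ 2 := by rw [hsq]
      rw [hT, this]
      ring
    have hcV : c * n * V = -(c ^ 2 * n / 2) + c * n * (ν₂ * (2 * β - 1)) + c * n * γ + n * l
        + c * n * Isph c α := by
      rw [hVdef]; field_simp; ring
    have hcε : c * n * ε = -(c * n * V) / 4 := by rw [hε]; ring
    linarith
  have hpi : 0 ≤ 2 * Real.exp 1 * Real.sqrt (2 * Real.pi) := by positivity
  calc 2 * Real.exp 1 * Real.sqrt (2 * Real.pi) * Real.exp T * E
      ≤ 2 * Real.exp 1 * Real.sqrt (2 * Real.pi) * Real.exp T *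
          (C₀ * Real.exp (c * n * (Isph c α + ε))) :=
        mul_le_mul_of_nonneg_left hE (mul_nonneg hpi (Real.exp_pos _).le)
    _ = 2 * Real.exp 1 * Real.sqrt (2 * Real.pi) *
          (C₀ * Real.exp (T + c * n * (Isph c α + ε))) := by rw [Real.exp_add T]; ring
    _ ≤ 2 * Real.exp 1 * Real.sqrt (2 * Real.pi) * (C₀ *
          Real.exp (1 / 2 + 2 * c * ν₂ + 4 * c / ε + -(c * (-V) / 2) * n)) := by gcongr
    _ = D * Real.exp (-(c * (-V) / 2) * n) := by rw [hD, Real.exp_add]; ring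
    _ ≤ (D + 1) * Real.exp (-(c * (-V) / 2) * n) := by gcongr; linarith

end L1Recovery

/-- First part: for all admissible parameters `E exp (c t)` is finite and is given by the closed
form. Second part: if the lifted condition holds then, in the linear regime `m = α n`, `k = β n`
(up to rounding), the probability that `ℓ₁`-minimization fails to recover some `k`-sparse vector
is exponentially small in `n`. -/
theorem mainTheorem1 :
    (∀ c γ ν₁ ν₂ : ℝ, 0 < c → c / 2 < γ → 0 ≤ ν₁ → 0 ≤ ν₂ →
      MeasureTheory.Integrable (fun h => Real.exp (c * L1Recovery.tStr γ ν₁ ν₂ h))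
        (ProbabilityTheory.gaussianReal 0 1) ∧
      L1Recovery.Imoment c γ ν₁ ν₂ = L1Recovery.closedI c γ ν₁ ν₂) ∧
    (∀ α β : ℝ, 0 < α → α ≤ 1 → 0 ≤ β → β ≤ 1 →
      L1Recovery.liftedValue α β < 0 →
      ∃ C η : ℝ, 0 < C ∧ 0 < η ∧
        ∀ n m k : ℕ, |(m : ℝ) - α * n| < 1 → |(k : ℝ) - β * n| < 1 →
          L1Recovery.gaussianEntries m n
              {A | ¬ L1Recovery.RecoversAll (Matrix.of A) k} ≤
            ENNReal.ofReal (C * Real.exp (-η * n))) :=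
  ⟨fun _ _ _ _ hc hγ h₁ h₂ => ⟨L1Recovery.integrable_exp_tStr hc hγ h₁ h₂,
    L1Recovery.Imoment_eq_closedI hc hγ h₁ h₂⟩,
    fun _ _ hα _ _ _ hlift => L1Recovery.exists_failure_bound hα hlift⟩
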